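/- Let $F$ be a finitely generated field of transcendence degree $1$ over $\mathbb{F}_p$, let $A\subset F$ be the ring of elements regular outside a fixed place $\infty$ of $F$, let $K$ be a field that is finitely generated over $\mathbb{F}_p$, and let $K^{\rm sep}$ be a separable closure of $K$. Write $K[\tau]$ for the twisted polynomial ring with $\tau c=c^p\tau$, acting on $K^{\rm sep}$ through $\tau(x)=x^p$. Let $\phi\colon A\to K[\tau]$ be a Drinfeld $A$-module (a ring homomorphism whose image is not contained in $K$) of characteristic $\mathfrak{p}_0=\ker(a\mapsto d\phi_a)$, and view $K^{\rm sep}$ as an $A$-module via $\phi$. Let $M\subset K$ be a finitely generated torsion free $A$-submodule. Put $A_{\rm ad}=\operatorname{End}_A(A_{(\mathfrak{p}_0)}/A)$ and, for any $A$-module $X$, put $T(X)=\operatorname{Hom}_A(A_{(\mathfrak{p}_0)}/A,X)$, an $A_{\rm ad}$-module. Let $\operatorname{Div}(M)=\{x\in K^{\rm sep}\mid \exists a\in A\setminus\mathfrak{p}_0:\phi_a(x)\in M\}$ and set $T_{\rm ad}(\phi)=T(\operatorname{Div}(0))$ and $T_{\rm ad}(\phi,M)=T(\operatorname{Div}(M)/M)$.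 The exact sequence $0\to\operatorname{Div}(0)\to\operatorname{Div}(M)/M\to M\otimes_A(A_{(\mathfrak{p}_0)}/A)\to0$, whose second map is $x\mapsto\phi_a(x)\otimes\frac1a$ for any $a\in A\setminus\mathfrak{p}_0$ with $\phi_a(x)\in M$, yields, together with the natural isomorphism $M\otimes_AA_{\rm ad}\cong T(M\otimes_A(A_{(\mathfrak{p}_0)}/A))$, an exact sequence of $A_{\rm ad}$-modules $$0\to T_{\rm ad}(\phi)\to T_{\rm ad}(\phi,M)\to M\otimes_AA_{\rm ad}\to0.\qquad(*)$$ Let $B\subset A$ be an integrally closed infinite subring, let $\psi=\phi|B$, which has characteristic $\mathfrak{q}_0=\mathfrak{p}_0\cap B$, and define $B_{\rm ad}$, $T_{\rm ad}(\psi)$, $T_{\rm ad}(\psi,M)$ and the exact sequence $(*)$ for $\psi$ and $M$ in the same way with $(B,\psi,\mathfrak{q}_0)$ in place of $(A,\phi,\mathfrak{p}_0)$. Then both sequences are well-defined and exact. There is a unique homomorphism of $A$-algebras $\pi\colon A_{\rm ad}\to A\otimes_BB_{\rm ad}$ such that for all $f\in A_{\rm ad}$, with $\pi(f)=\sum_k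 a_k\otimes g_k$, and all $d\in B_{(\mathfrak{q}_0)}/B$ one has $f(\iota(d))=\sum_k a_k\,\iota(g_k(d))$, where $\iota\colon B_{(\mathfrak{q}_0)}/B\to A_{(\mathfrak{p}_0)}/A$ is the natural map; and $\pi$ is surjective. The sequence $(*)$ for $\psi$ and $M$ is naturally isomorphic to that obtained from the sequence $(*)$ for $\phi$ and $M$ by tensoring with $A\otimes_BB_{\rm ad}$ over $A_{\rm ad}$ via $\pi$. More precisely, there is a commutative diagram with exact rows and surjective vertical arrows $$\begin{array}{ccccccccc} 0&\to& T_{\rm ad}(\phi)&\to& T_{\rm ad}(\phi,M)&\to& M\otimes_AA_{\rm ad}&\to&0\\ &&\downarrow&&\downarrow&&\downarrow&&\\ 0&\to& T_{\rm ad}(\psi)&\to& T_{\rm ad}(\psi,M)&\to& M\otimes_BB_{\rm ad}&\to&0, \end{array}$$ in which the left and middle vertical arrows are given by restricting homomorphisms from $A_{(\mathfrak{p}_0)}/A$ along $\iota$ and the right one is induced by $\pi$; each vertical arrow is $\pi$-semilinear and induces an isomorphism of $A\otimes_BB_{\rm ad}$-modules from the base change along $\pi$ of its source to its target. If $\mathfrak{p}_0$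 is the only prime ideal of $A$ above $\mathfrak{q}_0$, the vertical arrows are isomorphisms. -/

import Mathlib

open scoped TensorProduct

noncomputable section

namespace DrinfeldTate

/-! ### The ring `K[τ]` and its action on fields over `K` -/

section Twisted

variable (p : ℕ) [Fact p.Prime] (K : Type*) [Field K] [CharP K p]

/-- The action of `ℕ` on `K` through the powers of `c ↦ c ^ p`. -/
abbrev frobAction : MulSemiringAction (Multiplicative ℕ) K where
  smul n c := c ^ p ^ n.toAdd
  one_smul c := by change c ^ p ^ 0 = c; simp
  mul_smul m n c := by
    change c ^ p ^ (m.toAdd + n.toAdd) = (c ^ p ^ n.toAdd) ^ p ^ m.toAdd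
    rw [← pow_mul, ← pow_add, add_comm]
  smul_zero n := zero_pow (pow_ne_zero _ (Fact.out : p.Prime).ne_zero)
  smul_add n x y := add_pow_char_pow x y p n.toAdd
  smul_one n := one_pow _
  smul_mul n x y := mul_pow x y _

/-- `K[τ]`, the ring of polynomials in `τ` over `K` with `τ * c = c ^ p * τ`;
its multiplication is given by the instance below. -/
def TwistedPoly (p : ℕ) [Fact p.Prime] (K : Type*) [Field K] [CharP K p] : Type _ :=
  SkewPolynomial K

instance : Ring (TwistedPoly p K) :=
  letI := frobAction p K
  inferInstanceAs (Ring (SkewPolynomial K))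

variable {p K}

/-- The coefficient of `τ ^ n`. -/
def TwistedPoly.coeff (f : TwistedPoly p K) (n : ℕ) : K := SkewPolynomial.coeff f n

variable (p K)

theorem coeff_zero_add (f g : SkewPolynomial K) : SkewPolynomial.coeff (f + g) 0 =
    SkewPolynomial.coeff f 0 + SkewPolynomial.coeff g 0 := by
  rw [SkewPolynomial.coeff, SkewMonoidAlgebra.coeff_add]
  rfl

theorem coeff_zero_mul (f g : SkewPolynomial K) :
    SkewPolynomial.coeff (letI := frobAction p K; f * g) 0 =
      SkewPolynomial.coeff f 0 * SkewPolynomial.coeff g 0 := by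
  let _ := frobAction p K
  induction f using SkewPolynomial.induction with
  | h0 => rw [zero_mul, SkewPolynomial.coeff_zero, zero_mul]
  | ha n r f' _ _ hf' =>
    rw [add_mul, coeff_zero_add, coeff_zero_add, hf', add_mul]
    congr 1
    clear hf'
    induction g using SkewPolynomial.induction with
    | h0 => rw [mul_zero, SkewPolynomial.coeff_zero, mul_zero]
    | ha m t g' _ _ hg' =>
      rw [mul_add, coeff_zero_add, coeff_zero_add, hg', mul_add]
      congr 1
      rw [SkewPolynomial.monomial_mul_monomial, SkewPolynomial.coeff_monomial,
        SkewPolynomial.coeff_monomial, SkewPolynomial.coeff_monomial]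
      rcases n with _ | n
      · rcases m with _ | m <;> simp
      · simp

/-- The derivative `df` of `f ∈ K[τ]`, that is, the coefficient of `τ ^ 0`. -/
def derivHom : TwistedPoly p K →+* K where
  toFun f := f.coeff 0
  map_one' := SkewPolynomial.coeff_one_zero
  map_zero' := rfl
  map_add' f g := coeff_zero_add K f g
  map_mul' f g := coeff_zero_mul p K f g

variable (L : Type*) [Field L] [Algebra K L]

/-- The powers of `x ↦ x ^ p` on a field `L` over `K`. -/
def frobPow : Multiplicative ℕ →* AddMonoid.End L where
  toFun n :=
    { toFun := fun x ↦ x ^ p ^ n.toAdd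
      map_zero' := zero_pow (pow_ne_zero _ (Fact.out : p.Prime).ne_zero)
      map_add' := fun x y ↦
        have : CharP L p := charP_of_injective_algebraMap (algebraMap K L).injective p
        add_pow_char_pow x y p n.toAdd }
  map_one' := AddMonoidHom.ext fun x ↦ by
    change x ^ p ^ 0 = x
    simp
  map_mul' m n := AddMonoidHom.ext fun x ↦ by
    change x ^ p ^ (m.toAdd + n.toAdd) = (x ^ p ^ n.toAdd) ^ p ^ m.toAdd
    rw [← pow_mul, ← pow_add, add_comm]

/-- `f = ∑ c_i τ ^ i` acts on a field `L` over `K` by `x ↦ ∑ c_i x ^ (p ^ i)`. -/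
def evalHom : TwistedPoly p K →+* AddMonoid.End L :=
  letI := frobAction p K
  SkewMonoidAlgebra.liftNCRingHom (Module.toAddMonoidEnd K L) (frobPow p K L)
    (by
      intro c n
      refine AddMonoidHom.ext fun x ↦ ?_
      change (c ^ p ^ n.toAdd) • (x ^ p ^ n.toAdd) = (c • x) ^ p ^ n.toAdd
      rw [smul_pow])

/-- The formula for the action. -/
theorem evalHom_apply (f : TwistedPoly p K) (x : L) :
    evalHom p K L f x = SkewPolynomial.sum f (fun i c ↦ algebraMap K L c * x ^ p ^ i) := by
  have hl : ∀ g : SkewPolynomial K, SkewMonoidAlgebra.liftNC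
      ((Module.toAddMonoidEnd K L : K →+* AddMonoid.End L) : K →+ AddMonoid.End L)
      (frobPow p K L) g x =
      SkewPolynomial.sum g (fun i c ↦ algebraMap K L c * x ^ p ^ i) := by
    intro g
    induction g using SkewPolynomial.induction with
    | h0 => rw [map_zero]; rfl
    | ha n r q _ _ hq =>
      rw [map_add]
      refine (congrArg₂ (· + ·) rfl hq).trans ?_
      rw [ SkewPolynomial.sum_def', SkewPolynomial.sum_def',
        SkewMonoidAlgebra.sum_add_index' (by simp) (by intros; rw [map_add, add_mul])]
      refine congrArg₂ (· + ·) ?_ rfl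
      have hs : SkewPolynomial.sum (SkewPolynomial.monomial n r)
          (fun i c ↦ algebraMap K L c * x ^ p ^ i) = algebraMap K L r * x ^ p ^ n :=
        SkewPolynomial.sum_monomial_index (by simp)
      refine Eq.trans ?_ hs.symm
      rw [SkewPolynomial.monomial_def]
      refine (congrArg (fun u : AddMonoid.End L ↦ u x)
        (SkewMonoidAlgebra.liftNC_single _ _ _ _)).trans ?_
      exact Algebra.smul_def r (x ^ p ^ n)
  exact hl f

end Twisted

/-! ### Places, and the ring of functions regular outside a place -/

/-- The ring of all elements of `F` that are regular at all places different from `v`. For a field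
of transcendence degree one over `𝔽_p`, its places are the valuation rings `≠ F`. -/
def regularOutside {F : Type*} [Field F] (v : ValuationSubring F) : Subring F :=
  ⨅ P ∈ {P : ValuationSubring F | P ≠ ⊤ ∧ P ≠ v}, P.toSubring

/-! ### Algebra: torsion modules and their Tate modules -/

section Algebra

variable {R : Type*} [CommRing R] (𝔭 : Ideal R) [𝔭.IsPrime]

/-- The `R`-module `R_(𝔭) / R`. -/
abbrev LocQuot : Type _ :=
  Localization.AtPrime 𝔭 ⧸ LinearMap.range (Algebra.linearMap R (Localization.AtPrime 𝔭))

/-- The class of `c / s` in `R_(𝔭) / R`. -/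
def LocQuot.frac (c : R) (s : 𝔭.primeCompl) : LocQuot 𝔭 :=
  Submodule.Quotient.mk (Localization.mk c s)

/-- The prime-to-`𝔭` adelic completion `R_ad = End_R(R_(𝔭) / R)`. -/
def Aad : Type _ := Module.End R (LocQuot 𝔭)

instance : Ring (Aad 𝔭) := inferInstanceAs (Ring (Module.End R (LocQuot 𝔭)))

/-- The value of an element of `R_ad` as an endomorphism. -/
def Aad.toEnd (f : Aad 𝔭) : Module.End R (LocQuot 𝔭) := f

variable {𝔭} in
theorem LocQuot.exists_frac (x : LocQuot 𝔭) : ∃ c s, x = LocQuot.frac 𝔭 c s := by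
  obtain ⟨y, rfl⟩ := Submodule.Quotient.mk_surjective _ x
  obtain ⟨⟨c, s⟩, rfl⟩ := Localization.mkHom_surjective y
  exact ⟨c, s, rfl⟩

variable {𝔭} in
theorem LocQuot.frac_eq_smul (c : R) (s : 𝔭.primeCompl) :
    LocQuot.frac 𝔭 c s = c • LocQuot.frac 𝔭 1 s := by
  rw [LocQuot.frac, LocQuot.frac, ← Submodule.Quotient.mk_smul, Localization.smul_mk, smul_eq_mul,
    mul_one]

variable {𝔭} in
theorem LocQuot.smul_frac (s : 𝔭.primeCompl) : (s : R) • LocQuot.frac 𝔭 1 s = 0 := by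
  rw [LocQuot.frac, ← Submodule.Quotient.mk_smul, Submodule.Quotient.mk_eq_zero,
    Localization.smul_mk, smul_eq_mul, mul_one, Localization.mk_self]
  exact ⟨1, by simp⟩

variable {𝔭} in
theorem LocQuot.frac_mul (s t : 𝔭.primeCompl) :
    (t : R) • LocQuot.frac 𝔭 1 (s * t) = LocQuot.frac 𝔭 1 s := by
  rw [LocQuot.frac, LocQuot.frac, ← Submodule.Quotient.mk_smul, Localization.smul_mk, smul_eq_mul,
    mul_one]
  congr 1
  rw [Localization.mk_eq_mk_iff, Localization.r_iff_exists]
  exact ⟨1, by simp⟩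

variable {𝔭} in
theorem LocQuot.of_smul_eq_zero (s : 𝔭.primeCompl) (x : LocQuot 𝔭) (hx : (s : R) • x = 0) :
    ∃ a : R, x = a • LocQuot.frac 𝔭 1 s := by
  obtain ⟨y, rfl⟩ := Submodule.Quotient.mk_surjective _ x
  rw [← Submodule.Quotient.mk_smul, Submodule.Quotient.mk_eq_zero] at hx
  obtain ⟨a, ha⟩ := hx
  refine ⟨a, ?_⟩
  rw [LocQuot.frac, ← Submodule.Quotient.mk_smul, Localization.smul_mk, smul_eq_mul, mul_one]
  congr 1
  have hs : IsUnit (algebraMap R (Localization.AtPrime 𝔭) s) := IsLocalization.map_units _ s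
  refine hs.mul_left_cancel ?_
  rw [Algebra.linearMap_apply, Algebra.smul_def] at ha
  rw [← ha, ← Localization.mk_one_eq_algebraMap, ← Localization.mk_one_eq_algebraMap,
    Localization.mk_mul, Localization.mk_eq_mk_iff, Localization.r_iff_exists]
  exact ⟨1, by simp⟩

theorem Aad.exists_scalar (f : Aad 𝔭) (s : 𝔭.primeCompl) :
    ∃ a : R, f.toEnd 𝔭 (LocQuot.frac 𝔭 1 s) = a • LocQuot.frac 𝔭 1 s :=
  LocQuot.of_smul_eq_zero s _ (by rw [← map_smul, LocQuot.smul_frac, map_zero])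

instance : CommRing (Aad 𝔭) where
  mul_comm f g := by
    refine LinearMap.ext fun x ↦ ?_
    change f.toEnd 𝔭 (g.toEnd 𝔭 x) = g.toEnd 𝔭 (f.toEnd 𝔭 x)
    obtain ⟨c, s, rfl⟩ := x.exists_frac
    obtain ⟨a, ha⟩ := f.exists_scalar 𝔭 s
    obtain ⟨b, hb⟩ := g.exists_scalar 𝔭 s
    rw [LocQuot.frac_eq_smul]
    simp only [map_smul, ha, hb]
    rw [smul_comm b a]

instance : Algebra R (Aad 𝔭) := inferInstanceAs (Algebra R (Module.End R (LocQuot 𝔭)))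

section TMod

/-- `T(X) = Hom_R(R_(𝔭) / R, X)`. -/
def TMod (X : Type*) [AddCommGroup X] [Module R X] : Type _ := LocQuot 𝔭 →ₗ[R] X

variable {X Y : Type*} [AddCommGroup X] [Module R X] [AddCommGroup Y] [Module R Y]

instance : AddCommGroup (TMod 𝔭 X) := inferInstanceAs (AddCommGroup (LocQuot 𝔭 →ₗ[R] X))

/-- The value of an element of `T(X)` as a homomorphism. -/
def TMod.toHom (t : TMod 𝔭 X) : LocQuot 𝔭 →ₗ[R] X := t

/-- Any ring acting `R`-linearly on `X` acts on `T(X)`. -/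
instance {S : Type*} [Semiring S] [Module S X] [SMulCommClass R S X] : Module S (TMod 𝔭 X) :=
  inferInstanceAs (Module S (LocQuot 𝔭 →ₗ[R] X))

/-- `R_ad` acts on `T(X)` through its action on `R_(𝔭) / R`. -/
instance : Module (Aad 𝔭) (TMod 𝔭 X) where
  smul f t := (t.toHom 𝔭).comp (f.toEnd 𝔭)
  one_smul t := rfl
  mul_smul f g t := by
    rw [mul_comm]
    rfl
  smul_zero f := LinearMap.zero_comp _
  smul_add f t u := LinearMap.add_comp _ _ _
  add_smul f g t := LinearMap.comp_add _ _ _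
  zero_smul t := LinearMap.comp_zero _

/-- `T` as a functor. -/
def TMod.map (h : X →ₗ[R] Y) : TMod 𝔭 X →ₗ[Aad 𝔭] TMod 𝔭 Y where
  toFun t := h.comp (t.toHom 𝔭)
  map_add' _ _ := LinearMap.comp_add _ _ _
  map_smul' _ _ := rfl

variable (X) in
/-- The natural map `R_ad ⊗ X → T(X ⊗ R_(𝔭) / R)`, `f ⊗ x ↦ (d ↦ x ⊗ f d)`. -/
def TMod.ofTensorAux : Aad 𝔭 ⊗[R] X →+ TMod 𝔭 (X ⊗[R] LocQuot 𝔭) :=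
  TensorProduct.liftAddHom
    { toFun := fun f ↦
        { toFun := fun x ↦ ((TensorProduct.mk R X (LocQuot 𝔭) x).comp (f.toEnd 𝔭) :
            LocQuot 𝔭 →ₗ[R] X ⊗[R] LocQuot 𝔭)
          map_zero' := by
            refine LinearMap.ext fun d ↦ ?_
            exact TensorProduct.zero_tmul _ _
          map_add' := fun x y ↦ by
            refine LinearMap.ext fun d ↦ ?_
            exact TensorProduct.add_tmul _ _ _ }
      map_zero' := by
        refine AddMonoidHom.ext fun x ↦ LinearMap.ext fun d ↦ ?_
        exact TensorProduct.tmul_zero _ _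
      map_add' := fun f g ↦ by
        refine AddMonoidHom.ext fun x ↦ LinearMap.ext fun d ↦ ?_
        exact TensorProduct.tmul_add _ _ _ }
    (fun r f x ↦ LinearMap.ext fun d ↦ (TensorProduct.smul_tmul r x (f.toEnd 𝔭 d)).symm)

theorem TMod.ofTensorAux_smul (g f : Aad 𝔭) (x : X) :
    TMod.ofTensorAux 𝔭 X ((g * f) ⊗ₜ[R] x) = g • TMod.ofTensorAux 𝔭 X (f ⊗ₜ[R] x) := by
  rw [mul_comm]
  rfl

variable (X) in
/-- The natural map `R_ad ⊗ X → T(X ⊗ R_(𝔭) / R)` as an `R_ad`-linear map. -/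
def TMod.ofTensor : Aad 𝔭 ⊗[R] X →ₗ[Aad 𝔭] TMod 𝔭 (X ⊗[R] LocQuot 𝔭) where
  toFun := TMod.ofTensorAux 𝔭 X
  map_add' := map_add _
  map_smul' g z := by
    induction z using TensorProduct.induction_on with
    | zero => rw [smul_zero, map_zero, smul_zero]
    | add z w hz hw => rw [smul_add, map_add, hz, hw, map_add, smul_add]
    | tmul f x => exact TMod.ofTensorAux_smul 𝔭 g f x

end TMod

/-! ### Division hulls -/

section Div

variable {N : Type*} [AddCommGroup N] [Module R N]

/-- The prime-to-`𝔭` division hull of a submodule `M` of `N`. -/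
def Div (M : Submodule R N) : Submodule R N where
  carrier := {x | ∃ a ∉ 𝔭, a • x ∈ M}
  zero_mem' := ⟨1, 𝔭.primeCompl.one_mem, by simp⟩
  add_mem' := by
    rintro x y ⟨a, ha, hx⟩ ⟨b, hb, hy⟩
    refine ⟨a * b, 𝔭.primeCompl.mul_mem ha hb, ?_⟩
    rw [smul_add]
    refine M.add_mem ?_ ?_
    · rw [mul_comm, mul_smul]; exact M.smul_mem _ hx
    · rw [mul_smul]; exact M.smul_mem _ hy
  smul_mem' := by
    rintro c x ⟨a, ha, hx⟩
    exact ⟨a, ha, by rw [smul_comm]; exact M.smul_mem _ hx⟩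

theorem le_Div (M : Submodule R N) : M ≤ Div 𝔭 M :=
  fun x hx ↦ ⟨1, 𝔭.primeCompl.one_mem, by rwa [one_smul]⟩

theorem Div_mono {M M' : Submodule R N} (h : M ≤ M') : Div 𝔭 M ≤ Div 𝔭 M' :=
  fun _ ⟨a, ha, hx⟩ ↦ ⟨a, ha, h hx⟩

/-- The quotient of the division hull of `M` by `M`. -/
abbrev DivQuot (M : Submodule R N) : Type _ := ↥(Div 𝔭 M) ⧸ M.submoduleOf (Div 𝔭 M)

/-- The map from the prime-to-`𝔭` torsion of `N` to the division hull of `M` modulo `M`. -/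
def torsionToDivQuot (M : Submodule R N) : ↥(Div 𝔭 (⊥ : Submodule R N)) →ₗ[R] DivQuot 𝔭 M :=
  (M.submoduleOf (Div 𝔭 M)).mkQ.comp (Submodule.inclusion (Div_mono 𝔭 bot_le))

variable {𝔭} in
theorem div_welldef {M : Submodule R N} (x : N) (a b : 𝔭.primeCompl)
    (ha : (a : R) • x ∈ M) (hb : (b : R) • x ∈ M) :
    (⟨(a : R) • x, ha⟩ : M) ⊗ₜ[R] LocQuot.frac 𝔭 1 a =
      (⟨(b : R) • x, hb⟩ : M) ⊗ₜ[R] LocQuot.frac 𝔭 1 b := by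
  rw [← LocQuot.frac_mul a b, ← LocQuot.frac_mul b a, ← TensorProduct.smul_tmul,
    ← TensorProduct.smul_tmul, mul_comm b a]
  congr 1
  exact Subtype.ext (smul_comm _ _ _)

/-- The value at `x` of the map below. -/
def divToTensorFun (M : Submodule R N) (x : ↥(Div 𝔭 M)) : M ⊗[R] LocQuot 𝔭 :=
  (⟨x.2.choose • x.1, x.2.choose_spec.2⟩ : M) ⊗ₜ[R]
    LocQuot.frac 𝔭 1 ⟨x.2.choose, x.2.choose_spec.1⟩

theorem divToTensorFun_eq (M : Submodule R N) (x : ↥(Div 𝔭 M)) (a : 𝔭.primeCompl)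
    (ha : (a : R) • x.1 ∈ M) :
    divToTensorFun 𝔭 M x = (⟨(a : R) • x.1, ha⟩ : M) ⊗ₜ[R] LocQuot.frac 𝔭 1 a :=
  div_welldef x.1 ⟨x.2.choose, x.2.choose_spec.1⟩ a x.2.choose_spec.2 ha

/-- The map from the division hull of `M` to `M ⊗ R_(𝔭) / R` that sends `x` to `(a x) ⊗ 1 / a` for
any `a ∉ 𝔭` with `a x ∈ M`. -/
def divToTensor (M : Submodule R N) : ↥(Div 𝔭 M) →ₗ[R] M ⊗[R] LocQuot 𝔭 where
  toFun := divToTensorFun 𝔭 M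
  map_add' x y := by
    obtain ⟨a, ha, hx⟩ := x.2
    obtain ⟨b, hb, hy⟩ := y.2
    have hc : a * b ∈ 𝔭.primeCompl := 𝔭.primeCompl.mul_mem ha hb
    have hx' : (a * b) • x.1 ∈ M := by rw [mul_comm, mul_smul]; exact M.smul_mem _ hx
    have hy' : (a * b) • y.1 ∈ M := by rw [mul_smul]; exact M.smul_mem _ hy
    have hxy : (a * b) • (x + y).1 ∈ M := by
      rw [Submodule.coe_add, smul_add]; exact M.add_mem hx' hy'
    rw [divToTensorFun_eq 𝔭 M x ⟨_, hc⟩ hx', divToTensorFun_eq 𝔭 M y ⟨_, hc⟩ hy',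
      divToTensorFun_eq 𝔭 M (x + y) ⟨_, hc⟩ hxy, ← TensorProduct.add_tmul]
    congr 1
    exact Subtype.ext (smul_add _ _ _)
  map_smul' r x := by
    obtain ⟨a, ha, hx⟩ := x.2
    have hrx : a • (r • x).1 ∈ M := by
      rw [Submodule.coe_smul, smul_comm]; exact M.smul_mem _ hx
    rw [divToTensorFun_eq 𝔭 M x ⟨a, ha⟩ hx, divToTensorFun_eq 𝔭 M (r • x) ⟨a, ha⟩ hrx,
      RingHom.id_apply, TensorProduct.smul_tmul']
    congr 1
    exact Subtype.ext (smul_comm _ _ _)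

/-- The induced map from the division hull of `M` modulo `M`. -/
def divQuotToTensor (M : Submodule R N) : DivQuot 𝔭 M →ₗ[R] M ⊗[R] LocQuot 𝔭 :=
  (M.submoduleOf (Div 𝔭 M)).liftQ (divToTensor 𝔭 M) (by
    intro x hx
    have hx' : (1 : R) • x.1 ∈ M := by rw [one_smul]; exact hx
    have h0 : LocQuot.frac 𝔭 1 (1 : 𝔭.primeCompl) = 0 := by
      simpa using LocQuot.smul_frac (1 : 𝔭.primeCompl)
    change divToTensorFun 𝔭 M x = 0
    rw [divToTensorFun_eq 𝔭 M x 1 hx', h0, TensorProduct.tmul_zero])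

/-! ### The extended Tate module sequence of a submodule `M` of `N`

`0 → T(Div(0)) → T(Div(M) / M) → R_ad ⊗ M → 0`. -/

/-- The first map of the sequence. -/
def tateIncl (M : Submodule R N) :
    TMod 𝔭 ↥(Div 𝔭 (⊥ : Submodule R N)) →ₗ[Aad 𝔭] TMod 𝔭 (DivQuot 𝔭 M) :=
  TMod.map 𝔭 (torsionToDivQuot 𝔭 M)

open Classical in
/-- The second map of the sequence: the natural map to `T(M ⊗ R_(𝔭) / R)`, followed by the inverse
of the natural map `R_ad ⊗ M → T(M ⊗ R_(𝔭) / R)`. The latter is bijective whenever `M` is finitely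
generated projective; otherwise the value is meaningless. -/
def tateProj (M : Submodule R N) : TMod 𝔭 (DivQuot 𝔭 M) →ₗ[Aad 𝔭] Aad 𝔭 ⊗[R] M :=
  if h : Function.Bijective (TMod.ofTensor 𝔭 M) then
    (LinearEquiv.ofBijective _ h).symm.toLinearMap.comp (TMod.map 𝔭 (divQuotToTensor 𝔭 M))
  else 0

/-- The extended Tate module sequence is well-defined (that is, `R_ad ⊗ M` is identified with
`T(M ⊗ R_(𝔭) / R)` by the natural map) and short exact. -/
structure TateSequenceExact (M : Submodule R N) : Prop where
  ofTensor_bijective : Function.Bijective (TMod.ofTensor 𝔭 M)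
  injective : Function.Injective (tateIncl 𝔭 M)
  exact : Function.Exact (tateIncl 𝔭 M) (tateProj 𝔭 M)
  surjective : Function.Surjective (tateProj 𝔭 M)

end Div

end Algebra

/-! ### Change of rings -/

/-- Elements of `B` outside `𝔮` lie outside `𝔭`. -/
theorem not_mem_of_comap {B A : Type*} [CommRing B] [CommRing A] [Algebra B A]
    (𝔮 : Ideal B) (𝔭 : Ideal A) (h𝔮 : 𝔮 = 𝔭.comap (algebraMap B A)) {b : B} (hb : b ∉ 𝔮) :
    algebraMap B A b ∉ 𝔭 := fun h ↦ hb (h𝔮 ▸ h)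

section Change

variable {B A : Type*} [CommRing B] [CommRing A] [Algebra B A]
variable (𝔮 : Ideal B) [𝔮.IsPrime] (𝔭 : Ideal A) [𝔭.IsPrime]
variable (h𝔮 : 𝔮 = 𝔭.comap (algebraMap B A))

/-- The natural map `B_(𝔮) / B → A_(𝔭) / A`, `c / s ↦ c / s`, for `𝔮 = 𝔭 ∩ B`. -/
def locQuotMap : LocQuot 𝔮 →ₛₗ[algebraMap B A] LocQuot 𝔭 :=
  Submodule.mapQ _ _
    ({ toFun := Localization.localRingHom 𝔮 𝔭 (algebraMap B A) h𝔮
       map_add' := map_add _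
       map_smul' := fun b x ↦ by
        rw [Algebra.smul_def, Algebra.smul_def, map_mul, Localization.localRingHom_to_map] } :
      Localization.AtPrime 𝔮 →ₛₗ[algebraMap B A] Localization.AtPrime 𝔭)
    (by
      rintro _ ⟨b, rfl⟩
      exact ⟨algebraMap B A b, (Localization.localRingHom_to_map 𝔮 𝔭 (algebraMap B A) h𝔮 b).symm⟩)

theorem locQuotMap_frac (c : B) (s : 𝔮.primeCompl) :
    locQuotMap 𝔮 𝔭 h𝔮 (LocQuot.frac 𝔮 c s) = LocQuot.frac 𝔭 (algebraMap B A c)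
      ⟨algebraMap B A s, not_mem_of_comap 𝔮 𝔭 h𝔮 s.2⟩ := by
  rw [LocQuot.frac, locQuotMap, Submodule.mapQ_apply]
  refine congrArg Submodule.Quotient.mk ?_
  change Localization.localRingHom 𝔮 𝔭 (algebraMap B A) h𝔮 (Localization.mk c s) = _
  rw [Localization.mk_eq_mk', Localization.localRingHom_mk', Localization.mk_eq_mk']

/-- An element `∑ a_k ⊗ g_k` of `A ⊗_B B_ad` yields a map `B_(𝔮) / B → A_(𝔭) / A`,
`d ↦ ∑ a_k g_k(d)`. -/
def tensorToHom : A ⊗[B] Aad 𝔮 →+ (LocQuot 𝔮 →+ LocQuot 𝔭) :=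
  TensorProduct.liftAddHom
    { toFun := fun a ↦
        { toFun := fun g ↦ ((DistribSMul.toAddMonoidHom (LocQuot 𝔭) a).comp
            (locQuotMap 𝔮 𝔭 h𝔮).toAddMonoidHom).comp (g.toEnd 𝔮).toAddMonoidHom
          map_zero' := AddMonoidHom.ext fun d ↦ by
            change a • locQuotMap 𝔮 𝔭 h𝔮 0 = 0
            rw [map_zero, smul_zero]
          map_add' := fun f g ↦ AddMonoidHom.ext fun d ↦ by
            change a • locQuotMap 𝔮 𝔭 h𝔮 (f.toEnd 𝔮 d + g.toEnd 𝔮 d) =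
              a • locQuotMap 𝔮 𝔭 h𝔮 (f.toEnd 𝔮 d) + a • locQuotMap 𝔮 𝔭 h𝔮 (g.toEnd 𝔮 d)
            rw [map_add, smul_add] }
      map_zero' := AddMonoidHom.ext fun g ↦ AddMonoidHom.ext fun d ↦ zero_smul A _
      map_add' := fun a b ↦ AddMonoidHom.ext fun g ↦ AddMonoidHom.ext fun d ↦ add_smul a b _ }
    (fun b a g ↦ AddMonoidHom.ext fun d ↦ by
      change (b • a) • locQuotMap 𝔮 𝔭 h𝔮 (g.toEnd 𝔮 d) = a • locQuotMap 𝔮 𝔭 h𝔮 (b • g.toEnd 𝔮 d)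
      rw [map_smulₛₗ, Algebra.smul_def, mul_comm, mul_smul])

/-- `π : A_ad → A ⊗_B B_ad` is the natural map: if `π f = ∑ a_k ⊗ g_k`, then the restriction of the
endomorphism `f` of `A_(𝔭) / A` to `B_(𝔮) / B` is `d ↦ ∑ a_k g_k(d)`. -/
def IsNaturalMap (π : Aad 𝔭 →ₐ[A] A ⊗[B] Aad 𝔮) : Prop :=
  ∀ (f : Aad 𝔭) (d : LocQuot 𝔮),
    tensorToHom 𝔮 𝔭 h𝔮 (π f) d = f.toEnd 𝔭 (locQuotMap 𝔮 𝔭 h𝔮 d)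

/-! #### The vertical maps -/

section Vertical

variable {X X' : Type*} [AddCommGroup X] [Module A X] [AddCommGroup X'] [Module B X']

theorem exists_preimage (j : X' →ₛₗ[algebraMap B A] X)
    (hj : ∀ x : X, (∃ b ∉ 𝔮, algebraMap B A b • x = 0) → ∃ x', j x' = x)
    (t : TMod 𝔭 X) (d : LocQuot 𝔮) : ∃ x', j x' = t.toHom 𝔭 (locQuotMap 𝔮 𝔭 h𝔮 d) := by
  obtain ⟨c, s, rfl⟩ := d.exists_frac
  refine hj _ ⟨s, s.2, ?_⟩
  rw [← map_smul, ← map_smulₛₗ, LocQuot.frac_eq_smul, smul_comm, LocQuot.smul_frac, smul_zero,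
    map_zero, map_zero]

/-- The value at `d` of the restriction of `t` to `B_(𝔮) / B`, as an element of `X'`. -/
def resFun (j : X' →ₛₗ[algebraMap B A] X)
    (hj : ∀ x : X, (∃ b ∉ 𝔮, algebraMap B A b • x = 0) → ∃ x', j x' = x)
    (t : TMod 𝔭 X) (d : LocQuot 𝔮) : X' :=
  (exists_preimage 𝔮 𝔭 h𝔮 j hj t d).choose

theorem resFun_spec (j : X' →ₛₗ[algebraMap B A] X)
    (hj : ∀ x : X, (∃ b ∉ 𝔮, algebraMap B A b • x = 0) → ∃ x', j x' = x)
    (t : TMod 𝔭 X) (d : LocQuot 𝔮) :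
    j (resFun 𝔮 𝔭 h𝔮 j hj t d) = t.toHom 𝔭 (locQuotMap 𝔮 𝔭 h𝔮 d) :=
  (exists_preimage 𝔮 𝔭 h𝔮 j hj t d).choose_spec

/-- Let `X'` be a `B`-module embedded in an `A`-module `X` in such a way that it contains the
prime-to-`𝔮` torsion of `X`. For any `t : A_(𝔭) / A → X`, the restriction of `t` to `B_(𝔮) / B`
takes values in `X'`. This defines a map `T(X) → T(X')`. -/
def TMod.res (j : X' →ₛₗ[algebraMap B A] X) (hinj : Function.Injective j)
    (hj : ∀ x : X, (∃ b ∉ 𝔮, algebraMap B A b • x = 0) → ∃ x', j x' = x) :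
    TMod 𝔭 X →+ TMod 𝔮 X' where
  toFun t := ({
    toFun := resFun 𝔮 𝔭 h𝔮 j hj t
    map_add' := fun d d' ↦ hinj <| by
      rw [map_add, resFun_spec, resFun_spec, resFun_spec, map_add, map_add]
    map_smul' := fun b d ↦ hinj <| by
      rw [RingHom.id_apply, map_smulₛₗ, resFun_spec, resFun_spec, map_smulₛₗ, map_smul] } :
    LocQuot 𝔮 →ₗ[B] X')
  map_zero' := LinearMap.ext fun d ↦ hinj <|
    (resFun_spec 𝔮 𝔭 h𝔮 j hj 0 d).trans (map_zero j).symm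
  map_add' t u := LinearMap.ext fun d ↦ hinj <|
    (resFun_spec 𝔮 𝔭 h𝔮 j hj (t + u) d).trans <| by
      change _ = j (resFun 𝔮 𝔭 h𝔮 j hj t d + resFun 𝔮 𝔭 h𝔮 j hj u d)
      rw [map_add, resFun_spec, resFun_spec]
      rfl

/-- The defining property of the map `T(X) → T(X')`. -/
theorem TMod.res_spec (j : X' →ₛₗ[algebraMap B A] X) (hinj : Function.Injective j)
    (hj : ∀ x : X, (∃ b ∉ 𝔮, algebraMap B A b • x = 0) → ∃ x', j x' = x)
    (t : TMod 𝔭 X) (d : LocQuot 𝔮) :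
    j ((TMod.res 𝔮 𝔭 h𝔮 j hinj hj t).toHom 𝔮 d) = t.toHom 𝔭 (locQuotMap 𝔮 𝔭 h𝔮 d) :=
  resFun_spec 𝔮 𝔭 h𝔮 j hj t d

end Vertical

section DivChange

variable {N N' : Type*} [AddCommGroup N] [Module A N] [AddCommGroup N'] [Module B N']
variable (e : N' →ₛₗ[algebraMap B A] N) (he : Function.Bijective e)
variable (M : Submodule A N) (M' : Submodule B N') (hM : ∀ x, x ∈ M' ↔ e x ∈ M)

/-- The inclusion of the prime-to-`𝔮` division hull into the prime-to-`𝔭` division hull. -/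
def divMap : ↥(Div 𝔮 M') →ₛₗ[algebraMap B A] ↥(Div 𝔭 M) where
  toFun x := ⟨e x, by
    obtain ⟨b, hb, hx⟩ := x.2
    exact ⟨algebraMap B A b, not_mem_of_comap 𝔮 𝔭 h𝔮 hb, by
      rw [← map_smulₛₗ]; exact (hM _).1 hx⟩⟩
  map_add' x y := Subtype.ext (map_add e _ _)
  map_smul' b x := Subtype.ext (map_smulₛₗ e _ _)

theorem divMap_injective (he : Function.Injective e) :
    Function.Injective (divMap 𝔮 𝔭 h𝔮 e M M' hM) :=
  fun _ _ hxy ↦ Subtype.ext (he (congrArg Subtype.val hxy))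

/-- The induced map on the division hulls modulo `M`. -/
def divQuotMap : DivQuot 𝔮 M' →ₛₗ[algebraMap B A] DivQuot 𝔭 M :=
  Submodule.mapQ (M'.submoduleOf (Div 𝔮 M')) (M.submoduleOf (Div 𝔭 M)) (divMap 𝔮 𝔭 h𝔮 e M M' hM)
    (show M'.submoduleOf (Div 𝔮 M') ≤
        (M.submoduleOf (Div 𝔭 M)).comap (divMap 𝔮 𝔭 h𝔮 e M M' hM) from
      fun _ hx ↦ (hM _).1 hx)

theorem divQuotMap_injective : Function.Injective (divQuotMap 𝔮 𝔭 h𝔮 e M M' hM) := by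
  rw [injective_iff_map_eq_zero]
  intro x hx
  obtain ⟨y, rfl⟩ := Submodule.Quotient.mk_surjective _ x
  rw [divQuotMap, Submodule.mapQ_apply, Submodule.Quotient.mk_eq_zero] at hx
  rw [Submodule.Quotient.mk_eq_zero]
  exact (hM _).2 hx

/-- The vertical map `T_ad(φ) → T_ad(ψ)`. -/
def tateResTorsion :
    TMod 𝔭 ↥(Div 𝔭 (⊥ : Submodule A N)) →+ TMod 𝔮 ↥(Div 𝔮 (⊥ : Submodule B N')) :=
  have hbot : ∀ x, x ∈ (⊥ : Submodule B N') ↔ e x ∈ (⊥ : Submodule A N) := fun x ↦ by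
    rw [Submodule.mem_bot, Submodule.mem_bot, map_eq_zero_iff e he.1]
  TMod.res 𝔮 𝔭 h𝔮 (divMap 𝔮 𝔭 h𝔮 e ⊥ ⊥ hbot) (divMap_injective _ _ _ _ _ _ _ he.1) (by
    rintro ⟨x, _⟩ ⟨b, hb, hx⟩
    obtain ⟨y, rfl⟩ := he.2 x
    refine ⟨⟨y, b, hb, (hbot _).2 ?_⟩, rfl⟩
    rw [map_smulₛₗ]
    exact congrArg Subtype.val hx)

/-- The vertical map `T_ad(φ, M) → T_ad(ψ, M)`. -/
def tateResDivQuot : TMod 𝔭 (DivQuot 𝔭 M) →+ TMod 𝔮 (DivQuot 𝔮 M') :=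
  TMod.res 𝔮 𝔭 h𝔮 (divQuotMap 𝔮 𝔭 h𝔮 e M M' hM) (divQuotMap_injective _ _ _ _ _ _ _) (by
    intro x ⟨b, hb, hx⟩
    obtain ⟨⟨x, hxd⟩, rfl⟩ := Submodule.Quotient.mk_surjective _ x
    obtain ⟨y, rfl⟩ := he.2 x
    rw [← Submodule.Quotient.mk_smul, Submodule.Quotient.mk_eq_zero] at hx
    refine ⟨Submodule.Quotient.mk ⟨y, b, hb, (hM _).2 ?_⟩, rfl⟩
    rw [map_smulₛₗ]
    exact hx)

theorem tateResTorsion_spec (t : TMod 𝔭 ↥(Div 𝔭 (⊥ : Submodule A N))) (d : LocQuot 𝔮) :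
    e ((tateResTorsion 𝔮 𝔭 h𝔮 e he t).toHom 𝔮 d).1 = (t.toHom 𝔭 (locQuotMap 𝔮 𝔭 h𝔮 d)).1 :=
  congrArg Subtype.val (TMod.res_spec 𝔮 𝔭 h𝔮 (divMap 𝔮 𝔭 h𝔮 e ⊥ ⊥ _)
    (divMap_injective _ _ _ _ _ _ _ he.1) _ t d)

theorem tateResDivQuot_spec (t : TMod 𝔭 (DivQuot 𝔭 M)) (d : LocQuot 𝔮) :
    divQuotMap 𝔮 𝔭 h𝔮 e M M' hM ((tateResDivQuot 𝔮 𝔭 h𝔮 e he M M' hM t).toHom 𝔮 d) =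
      t.toHom 𝔭 (locQuotMap 𝔮 𝔭 h𝔮 d) :=
  TMod.res_spec 𝔮 𝔭 h𝔮 (divQuotMap 𝔮 𝔭 h𝔮 e M M' hM) (divQuotMap_injective _ _ _ _ _ _ _) _ t d

end DivChange

/-! #### The module structures over `A ⊗_B B_ad` -/

section TensorModule

variable {X : Type*} [AddCommGroup X] [Module B X] [Module A X] [IsScalarTower B A X]

/-- For an `A`-module `X`, the module `Hom_B(B_(𝔮) / B, X)` is a module over `A ⊗_B B_ad`,
where `a ⊗ g` acts by `t ↦ a ∘ t ∘ g`. -/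
@[reducible] def TMod.tensorModule : Module (A ⊗[B] Aad 𝔮) (TMod 𝔮 X) :=
  haveI : SMulCommClass B A X := IsScalarTower.to_smulCommClass
  haveI : IsScalarTower B A (TMod 𝔮 X) := ⟨fun b a t ↦ LinearMap.ext fun d ↦
    smul_assoc b a (t.toHom 𝔮 d)⟩
  haveI : IsScalarTower B (Aad 𝔮) (TMod 𝔮 X) := ⟨fun b f t ↦ LinearMap.ext fun d ↦
    map_smul (t.toHom 𝔮) b (f.toEnd 𝔮 d)⟩
  haveI : SMulCommClass A (Aad 𝔮) (TMod 𝔮 X) := ⟨fun _ _ _ ↦ rfl⟩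
  TensorProduct.Algebra.module

theorem TMod.tensorModule_smul (a : A) (g : Aad 𝔮) (t : TMod 𝔮 X) (d : LocQuot 𝔮) :
    letI := TMod.tensorModule (A := A) 𝔮 (X := X)
    ((a ⊗ₜ[B] g) • t).toHom 𝔮 d = a • t.toHom 𝔮 (g.toEnd 𝔮 d) :=
  rfl

/-- For an `A`-module `X`, the module `B_ad ⊗_B X` is a module over `A ⊗_B B_ad`,
where `a ⊗ g` acts by `f ⊗ x ↦ (g f) ⊗ (a x)`. -/
@[reducible] def adTensorModule : Module (A ⊗[B] Aad 𝔮) (Aad 𝔮 ⊗[B] X) :=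
  haveI : SMulCommClass B A X := IsScalarTower.to_smulCommClass
  letI : Module A (Aad 𝔮 ⊗[B] X) := Module.compHom _
    ((Module.End.lTensorAlgHom B X (Aad 𝔮)).toRingHom.comp
      (Module.toModuleEnd B X : A →+* Module.End B X))
  haveI : IsScalarTower B A (Aad 𝔮 ⊗[B] X) := ⟨fun b a z ↦ by
    induction z using TensorProduct.induction_on with
    | zero => simp only [smul_zero]
    | add z w hz hw => simp only [smul_add, hz, hw]
    | tmul f x =>
      change f ⊗ₜ[B] ((b • a) • x) = b • (f ⊗ₜ[B] (a • x))
      rw [smul_assoc, TensorProduct.tmul_smul]⟩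
  haveI : SMulCommClass A (Aad 𝔮) (Aad 𝔮 ⊗[B] X) := ⟨fun a g z ↦ by
    induction z using TensorProduct.induction_on with
    | zero => simp only [smul_zero]
    | add z w hz hw => simp only [smul_add, hz, hw]
    | tmul f x => rfl⟩
  TensorProduct.Algebra.module

theorem adTensorModule_smul (a : A) (g f : Aad 𝔮) (x : X) :
    letI := adTensorModule (A := A) 𝔮 (X := X)
    (a ⊗ₜ[B] g) • (f ⊗ₜ[B] x) = (g * f) ⊗ₜ[B] (a • x) :=
  rfl

variable {Y : Type*} [AddCommGroup Y] [Module A Y]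

/-- For a ring homomorphism `π : A_ad → A ⊗_B B_ad` and an `A`-linear map `k : Y → X`, the map
`A_ad ⊗_A Y → B_ad ⊗_B X`, `f ⊗ y ↦ π(f) (1 ⊗ k y)`. -/
def adTensorMap (π : Aad 𝔭 →ₐ[A] A ⊗[B] Aad 𝔮) (k : Y →ₗ[A] X) :
    Aad 𝔭 ⊗[A] Y →+ Aad 𝔮 ⊗[B] X :=
  letI := adTensorModule (A := A) 𝔮 (X := X)
  TensorProduct.liftAddHom
    { toFun := fun f ↦
        { toFun := fun y ↦ π f • ((1 : Aad 𝔮) ⊗ₜ[B] k y)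
          map_zero' := by rw [map_zero, TensorProduct.tmul_zero, smul_zero]
          map_add' := fun y z ↦ by rw [map_add, TensorProduct.tmul_add, smul_add] }
      map_zero' := AddMonoidHom.ext fun y ↦ by
        change π 0 • ((1 : Aad 𝔮) ⊗ₜ[B] k y) = 0
        rw [map_zero, zero_smul]
      map_add' := fun f g ↦ AddMonoidHom.ext fun y ↦ by
        change π (f + g) • ((1 : Aad 𝔮) ⊗ₜ[B] k y) = π f • ((1 : Aad 𝔮) ⊗ₜ[B] k y) + π g • ((1 : Aad 𝔮) ⊗ₜ[B] k y)
        rw [map_add, add_smul] }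
    (fun a f y ↦ by
      change π (a • f) • ((1 : Aad 𝔮) ⊗ₜ[B] k y) = π f • ((1 : Aad 𝔮) ⊗ₜ[B] k (a • y))
      rw [map_smul, Algebra.smul_def, mul_comm, mul_smul, map_smul]
      rfl)

end TensorModule

/-! #### Submodules of `A`-modules that are stable under `A` -/

section Stable

theorem bot_stable {B A N : Type*} [CommRing B] [CommRing A] [AddCommGroup N] [Module B N]
    [Module A N] (a : A) (x : N) (hx : x ∈ (⊥ : Submodule B N)) :
    a • x ∈ (⊥ : Submodule B N) := by
  rw [Submodule.mem_bot] at hx ⊢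
  rw [hx, smul_zero]

variable {N : Type*} [AddCommGroup N] [Module B N] [Module A N] [IsScalarTower B A N]
variable (M : Submodule B N) (hA : ∀ (a : A) (x : N), x ∈ M → a • x ∈ M)

/-- The action of `A` on a stable submodule. -/
@[reducible] def stableModule : Module A M where
  smul a x := ⟨a • x.1, hA a x.1 x.2⟩
  one_smul x := Subtype.ext (one_smul A x.1)
  mul_smul a b x := Subtype.ext (mul_smul a b x.1)
  smul_zero a := Subtype.ext (smul_zero a)
  smul_add a x y := Subtype.ext (smul_add a x.1 y.1)
  add_smul a b x := Subtype.ext (add_smul a b x.1)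
  zero_smul x := Subtype.ext (zero_smul A x.1)

theorem stableModule_tower : letI := stableModule M hA; IsScalarTower B A M :=
  letI := stableModule M hA
  ⟨fun b a x ↦ Subtype.ext (smul_assoc b a x.1)⟩

variable {M} in
theorem Div_stable (hA : ∀ (a : A) (x : N), x ∈ M → a • x ∈ M) (a : A) (x : N) (hx : x ∈ Div 𝔮 M) : a • x ∈ Div 𝔮 M := by
  obtain ⟨b, hb, hx⟩ := hx
  have : SMulCommClass B A N := IsScalarTower.to_smulCommClass
  exact ⟨b, hb, by rw [smul_comm]; exact hA a _ hx⟩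

/-- Multiplication by `a` on the division hull of `M` modulo `M`. -/
def divQuotMul (a : A) : DivQuot 𝔮 M →ₗ[B] DivQuot 𝔮 M :=
  haveI : SMulCommClass B A N := IsScalarTower.to_smulCommClass
  Submodule.mapQ (M.submoduleOf (Div 𝔮 M)) (M.submoduleOf (Div 𝔮 M))
    ((Module.toModuleEnd B N a).restrict (Div_stable 𝔮 hA a))
    (show M.submoduleOf (Div 𝔮 M) ≤ (M.submoduleOf (Div 𝔮 M)).comap
        ((Module.toModuleEnd B N a).restrict (Div_stable 𝔮 hA a)) from
      fun x hx ↦ hA a x.1 hx)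

/-- The action of `A` on the division hull of `M` modulo `M`. -/
@[reducible] def divQuotModule : Module A (DivQuot 𝔮 M) where
  smul a x := divQuotMul 𝔮 M hA a x
  one_smul x := by
    obtain ⟨y, rfl⟩ := Submodule.Quotient.mk_surjective _ x
    exact congrArg Submodule.Quotient.mk (Subtype.ext (one_smul A y.1))
  mul_smul a b x := by
    obtain ⟨y, rfl⟩ := Submodule.Quotient.mk_surjective _ x
    exact congrArg Submodule.Quotient.mk (Subtype.ext (mul_smul a b y.1))
  smul_zero a := map_zero (divQuotMul 𝔮 M hA a)
  smul_add a x y := map_add (divQuotMul 𝔮 M hA a) x y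
  add_smul a b x := by
    obtain ⟨y, rfl⟩ := Submodule.Quotient.mk_surjective _ x
    exact congrArg Submodule.Quotient.mk (Subtype.ext (add_smul a b y.1))
  zero_smul x := by
    obtain ⟨y, rfl⟩ := Submodule.Quotient.mk_surjective _ x
    exact congrArg Submodule.Quotient.mk (Subtype.ext (zero_smul A y.1))

theorem divQuotModule_tower : letI := divQuotModule 𝔮 M hA; IsScalarTower B A (DivQuot 𝔮 M) :=
  letI := divQuotModule 𝔮 M hA
  ⟨fun b a x ↦ by
    obtain ⟨y, rfl⟩ := Submodule.Quotient.mk_surjective _ x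
    exact congrArg Submodule.Quotient.mk (Subtype.ext (smul_assoc b a y.1))⟩

end Stable

end Change

/-- For a ring homomorphism `π : R → S`, an `R`-module `X` and an `S`-module `Y`: the additive map
`v : X → Y` is `π`-semilinear and induces an isomorphism `S ⊗_R X ≅ Y`. -/
def IsBaseChangeAlong {R S X Y : Type*} [CommRing R] [CommRing S] (π : R →+* S)
    [AddCommGroup X] [Module R X] [AddCommGroup Y] (modY : Module S Y) (v : X →+ Y) : Prop :=
  ∃ hv : ∀ (r : R) (x : X), v (r • x) = π r • v x,
    letI : Algebra R S := π.toAlgebra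
    letI : Module R Y := Module.compHom Y π
    haveI : IsScalarTower R S Y := ⟨fun r s y ↦ mul_smul (π r) s y⟩
    IsBaseChange S ({ toFun := v, map_add' := map_add v, map_smul' := hv } : X →ₗ[R] Y)

/-! ### Drinfeld modules -/

section Drinfeld

variable {p : ℕ} [Fact p.Prime] {K : Type*} [Field K] [CharP K p]

section Basic

variable {R : Type*} [CommRing R] (φ : R →+* TwistedPoly p K)

/-- A ring homomorphism `R → K[τ]` is a Drinfeld module if its image is not contained in `K`. -/
def IsDrinfeld : Prop := ∃ (a : R) (n : ℕ), n ≠ 0 ∧ (φ a).coeff n ≠ 0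

/-- The characteristic of `φ`, that is, the kernel of `a ↦ dφ_a`. -/
def characteristic : Ideal R := RingHom.ker ((derivHom p K).comp φ)

instance : (characteristic φ).IsPrime := RingHom.ker_isPrime _

/-- The additive group of `L`, on which `R` acts by `a • x = φ_a(x)`. -/
def Points {R : Type*} [CommRing R] (_φ : R →+* TwistedPoly p K) (L : Type*) [Field L]
    [Algebra K L] : Type _ := L

variable (L : Type*) [Field L] [Algebra K L]

instance : AddCommGroup (Points φ L) := inferInstanceAs (AddCommGroup L)

instance : Module R (Points φ L) :=
  letI := Module.compHom L ((evalHom p K L).comp φ)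
  inferInstanceAs (Module R L)

end Basic

section Restrict

variable {A : Type*} [CommRing A] (φ : A →+* TwistedPoly p K) (B : Subring A)

/-- The restriction `ψ = φ|B`. -/
def restrict : B →+* TwistedPoly p K := φ.comp B.subtype

theorem characteristic_restrict :
    characteristic (restrict φ B) = (characteristic φ).comap (algebraMap B A) := rfl

variable (L : Type*) [Field L] [Algebra K L]

/-- `A` acts through `φ` on the additive group of `L` also if it is viewed as a `B`-module
through `ψ`. -/
instance : Module A (Points (restrict φ B) L) := inferInstanceAs (Module A (Points φ L))

instance : IsScalarTower B A (Points (restrict φ B) L) :=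
  ⟨fun b a x ↦ mul_smul (b : A) a (show Points φ L from x)⟩

/-- The identity map of `L`. -/
def pointsId : Points (restrict φ B) L →ₛₗ[algebraMap B A] Points φ L where
  toFun x := x
  map_add' _ _ := rfl
  map_smul' _ _ := rfl

theorem pointsId_bijective : Function.Bijective (pointsId φ B L) := Function.bijective_id

variable {L} {φ} (M : Submodule A (Points φ L))

/-- An `A`-submodule of `L` with respect to `φ`, viewed as a `B`-submodule with respect to `ψ`. -/
def restrictSub : Submodule B (Points (restrict φ B) L) := M.comap (pointsId φ B L)

theorem restrictSub_stable (a : A) (x : Points (restrict φ B) L) (hx : x ∈ restrictSub B M) :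
    a • x ∈ restrictSub B M := M.smul_mem a hx

/-- `A` acts on `M` viewed as a `B`-module. -/
instance : Module A (restrictSub B M) := stableModule _ (restrictSub_stable B M)

instance : IsScalarTower B A (restrictSub B M) := stableModule_tower _ (restrictSub_stable B M)

/-- The identity map of `M`. -/
def restrictSubId : M →ₗ[A] restrictSub B M where
  toFun x := ⟨x.1, x.2⟩
  map_add' _ _ := rfl
  map_smul' _ _ := rfl

end Restrict

/-! #### The Tate modules of a Drinfeld module -/

section Tate

variable {R : Type*} [CommRing R] (φ : R →+* TwistedPoly p K) (L : Type*) [Field L] [Algebra K L]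

/-- The prime-to-`𝔭₀` adelic completion `R_ad` of `R`, where `𝔭₀` is the characteristic of `φ`. -/
abbrev Rad : Type _ := Aad (characteristic φ)

/-- `T_ad(φ)`, where `L` is a separable closure of `K`. -/
abbrev Tad : Type _ :=
  TMod (characteristic φ) ↥(Div (characteristic φ) (⊥ : Submodule R (Points φ L)))

variable {φ L}

/-- `T_ad(φ, M)`. -/
abbrev TadExt (M : Submodule R (Points φ L)) : Type _ :=
  TMod (characteristic φ) (DivQuot (characteristic φ) M)

/-- `T_ad(φ) → T_ad(φ, M)`. -/
abbrev tadIncl (M : Submodule R (Points φ L)) : Tad φ L →ₗ[Rad φ] TadExt M :=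
  tateIncl (characteristic φ) M

/-- `T_ad(φ, M) → M ⊗ R_ad`. -/
abbrev tadProj (M : Submodule R (Points φ L)) : TadExt M →ₗ[Rad φ] Rad φ ⊗[R] M :=
  tateProj (characteristic φ) M

end Tate

section Vertical

variable {A : Type*} [CommRing A] (φ : A →+* TwistedPoly p K) (B : Subring A)
variable (L : Type*) [Field L] [Algebra K L]

/-- The ring `A ⊗_B B_ad`. -/
abbrev ABad : Type _ := A ⊗[B] Rad (restrict φ B)

/-- `A ⊗_B B_ad` acts on `T_ad(ψ)`. -/
@[reducible] def tadModule : Module (ABad φ B) (Tad (restrict φ B) L) :=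
  letI := stableModule (A := A) (Div (characteristic (restrict φ B))
    (⊥ : Submodule B (Points (restrict φ B) L))) (Div_stable _ (bot_stable (A := A)))
  haveI := stableModule_tower (A := A) (Div (characteristic (restrict φ B))
    (⊥ : Submodule B (Points (restrict φ B) L))) (Div_stable _ (bot_stable (A := A)))
  TMod.tensorModule (A := A) (characteristic (restrict φ B))

/-- The map `T_ad(φ) → T_ad(ψ)` that sends `t : A_(𝔭₀) / A → Div(0)` to its restriction to
`B_(𝔮₀) / B`. -/
def vertTad : Tad φ L →+ Tad (restrict φ B) L :=
  tateResTorsion _ _ (characteristic_restrict φ B) (pointsId φ B L) (pointsId_bijective φ B L)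

variable {φ L} (M : Submodule A (Points φ L))

/-- `A ⊗_B B_ad` acts on `T_ad(ψ, M)`. -/
@[reducible] def tadExtModule : Module (ABad φ B) (TadExt (restrictSub B M)) :=
  letI := divQuotModule (characteristic (restrict φ B)) _ (restrictSub_stable B M)
  haveI := divQuotModule_tower (characteristic (restrict φ B)) _ (restrictSub_stable B M)
  TMod.tensorModule (A := A) (characteristic (restrict φ B))

/-- The map `T_ad(φ, M) → T_ad(ψ, M)` that sends `t : A_(𝔭₀) / A → Div(M) / M` to its restriction
to `B_(𝔮₀) / B`. -/
def vertTadExt : TadExt M →+ TadExt (restrictSub B M) :=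
  tateResDivQuot _ _ (characteristic_restrict φ B) (pointsId φ B L) (pointsId_bijective φ B L)
    M (restrictSub B M) (fun _ ↦ Iff.rfl)

/-- `A ⊗_B B_ad` acts on `M ⊗_B B_ad`. -/
@[reducible] def radTensorModule :
    Module (ABad φ B) (Rad (restrict φ B) ⊗[B] restrictSub B M) :=
  adTensorModule _

/-- The map `M ⊗_A A_ad → M ⊗_A (A ⊗_B B_ad) = M ⊗_B B_ad` induced by a homomorphism
`π : A_ad → A ⊗_B B_ad`. -/
def vertTensor (π : Rad φ →ₐ[A] ABad φ B) :
    Rad φ ⊗[A] M →+ Rad (restrict φ B) ⊗[B] restrictSub B M :=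
  adTensorMap _ _ π (restrictSubId B M)

end Vertical

end Drinfeld

end DrinfeldTate

end

noncomputable section

namespace DrinfeldTate

/-! ### The functor `T`: tensor products and lifting along surjections -/

section Sequence

variable {R : Type*} [CommRing R] (𝔭 : Ideal R) [𝔭.IsPrime]
variable {X Y : Type*} [AddCommGroup X] [Module R X] [AddCommGroup Y] [Module R Y]

/-! Write D_A = A_(𝔭)/A and D_B = B_(𝔮)/B.

Exactness. Over a Dedekind domain the finitely generated torsion free module M is projective, hence
flat, and a dual basis inverts the natural map A_ad ⊗ M → T(M ⊗ D_A) (`TMod.ofTensor_bijective`).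
The sequence 0 → Div(0) → Div(M)/M → M ⊗ D_A → 0 is exact because M is torsion free, because M is
flat, and because a separably closed field is divisible by every a outside the characteristic:
φ_a(X) - y has the nonzero constant derivative dφ_a (`exists_points_smul_eq`). The functor T is left
exact. It keeps the last map surjective since A is countable, so that a homomorphism out of D_A is a
compatible sequence, and since the kernel Div(0) is divisible, so that such a sequence can be lifted
term by term (`TMod.map_surjective`).

Comparison. The natural map A ⊗_B D_B → D_A is injective, and its image is the prime-to-𝔮 torsion of
D_A. As A is finite projective over B, this identifies A ⊗_B B_ad with the semilinear homomorphisms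
D_B → D_A, and π is restriction of endomorphisms to D_B (`exists_unique_isNaturalMap`). The key
point is that the prime-to-𝔮 torsion is a direct summand of D_A: every element is killed by a
nonzero β in B, and the ideal (β) splits into a power of 𝔮 and a factor coprime to 𝔮. The projection
e onto this summand lies in A_ad (`exists_isTorsionProjection`). Homomorphisms on D_B thus extend to
D_A, so restriction is surjective. Its kernel is fixed by 1 - e, and π(1 - e) = 0. This says that π
and the first two vertical maps are base changes along a surjection
(`isBaseChangeAlong_of_surjective`). The third column inherits the same properties by a diagram
chase. If 𝔭 is the only prime above 𝔮, there is no 𝔮-primary part and e = 1.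

Arithmetic input. The infinite ring B contains an x transcendental over 𝔽_p, and A is the integral
closure of 𝔽_p[x] in F. It is finite over 𝔽_p[x] because Frobenius on 𝔽_p[x] is finite, which takes
care of inseparability. Hence A and B are countable Dedekind domains and A is finite over B
(`regularOutside_isDedekindDomain`). -/

theorem TMod.ext {t u : TMod 𝔭 X} (h : ∀ d, t.toHom 𝔭 d = u.toHom 𝔭 d) : t = u :=
  LinearMap.ext h

theorem TMod.ofTensor_tmul (f : Aad 𝔭) (x : X) (d : LocQuot 𝔭) :
    (TMod.ofTensor 𝔭 X (f ⊗ₜ x)).toHom 𝔭 d = x ⊗ₜ f.toEnd 𝔭 d := rfl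

theorem TMod.add_toHom (t u : TMod 𝔭 X) (d : LocQuot 𝔭) :
    (t + u).toHom 𝔭 d = t.toHom 𝔭 d + u.toHom 𝔭 d := rfl

theorem TMod.sub_toHom (t u : TMod 𝔭 X) (d : LocQuot 𝔭) :
    (t - u).toHom 𝔭 d = t.toHom 𝔭 d - u.toHom 𝔭 d := rfl

theorem TMod.zero_toHom (d : LocQuot 𝔭) : (0 : TMod 𝔭 X).toHom 𝔭 d = 0 := rfl

theorem TMod.aad_smul_toHom (f : Aad 𝔭) (t : TMod 𝔭 X) (d : LocQuot 𝔭) :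
    (f • t).toHom 𝔭 d = t.toHom 𝔭 (f.toEnd 𝔭 d) := rfl

theorem TMod.map_toHom (h : X →ₗ[R] Y) (t : TMod 𝔭 X) (d : LocQuot 𝔭) :
    (TMod.map 𝔭 h t).toHom 𝔭 d = h (t.toHom 𝔭 d) := rfl

theorem TMod.sum_toHom {ι : Type*} (s : Finset ι) (t : ι → TMod 𝔭 X) (d : LocQuot 𝔭) :
    (∑ i ∈ s, t i).toHom 𝔭 d = ∑ i ∈ s, (t i).toHom 𝔭 d :=
  map_sum (⟨⟨fun u : TMod 𝔭 X ↦ u.toHom 𝔭 d, rfl⟩, fun _ _ ↦ rfl⟩ : TMod 𝔭 X →+ X) t s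

/-- An endomorphism of `R_(𝔭) / R` as an element of `R_ad`. -/
def Aad.ofEnd (f : Module.End R (LocQuot 𝔭)) : Aad 𝔭 := f

theorem Aad.ofEnd_toEnd (f : Module.End R (LocQuot 𝔭)) : (Aad.ofEnd 𝔭 f).toEnd 𝔭 = f := rfl

theorem Aad.ofEnd_add (f g : Module.End R (LocQuot 𝔭)) :
    Aad.ofEnd 𝔭 (f + g) = Aad.ofEnd 𝔭 f + Aad.ofEnd 𝔭 g := rfl

/-- A homomorphism from `R_(𝔭) / R` to `X` as an element of `T(X)`. -/
def TMod.ofHom (t : LocQuot 𝔭 →ₗ[R] X) : TMod 𝔭 X := t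

/-- For a finitely generated projective module `X`, the natural map `R_ad ⊗ X → T(X ⊗ R_(𝔭) / R)`
is bijective. -/
theorem TMod.ofTensor_bijective [Module.Finite R X] [Module.Projective R X] :
    Function.Bijective (TMod.ofTensor 𝔭 X) := by
  obtain ⟨n, f, g, -, -, hfg⟩ := Module.Finite.exists_comp_eq_id_of_projective R X
  let x : Fin n → X := fun i ↦ f (Pi.single i 1)
  let l : Fin n → X →ₗ[R] R := fun i ↦ (LinearMap.proj i).comp g
  have hl : ∀ y, ∑ i, l i y • x i = y := fun y ↦ by
    conv_rhs => rw [← LinearMap.id_apply (R := R) y, ← hfg]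
    rw [LinearMap.comp_apply, LinearMap.pi_apply_eq_sum_univ f (g y)]
    refine Finset.sum_congr rfl fun i _ ↦ ?_
    refine congrArg (fun v ↦ g y i • f v) (funext fun j ↦ ?_)
    rw [Pi.single_apply]
    exact if_congr eq_comm rfl rfl
  -- The `x i` and `l i` form a dual basis of `X`. Applying the coordinate `l i` to the values of
  -- `t` gives an endomorphism of R_(𝔭)/R, the coefficient of `x i`.
  let inv (t : TMod 𝔭 (X ⊗[R] LocQuot 𝔭)) : Aad 𝔭 ⊗[R] X :=
    ∑ i, Aad.ofEnd 𝔭 (((TensorProduct.lid R (LocQuot 𝔭)).toLinearMap.comp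
      ((l i).rTensor (LocQuot 𝔭))).comp (t.toHom 𝔭)) ⊗ₜ[R] x i
  have hinv_add : ∀ t u, inv (t + u) = inv t + inv u := fun t u ↦ by
    rw [← Finset.sum_add_distrib]
    refine Finset.sum_congr rfl fun i _ ↦ ?_
    rw [← TensorProduct.add_tmul, ← Aad.ofEnd_add, ← LinearMap.comp_add]
    rfl
  have hinv0 : inv 0 = 0 := by
    have := hinv_add 0 0
    rwa [add_zero, left_eq_add] at this
  refine Function.bijective_iff_has_inverse.2 ⟨inv, fun z ↦ ?_, fun t ↦ ?_⟩
  · induction z using TensorProduct.induction_on with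
    | zero => rw [map_zero, hinv0]
    | add z w hz hw => rw [map_add, hinv_add, hz, hw]
    | tmul a y =>
      conv_rhs => rw [← hl y, TensorProduct.tmul_sum]
      refine Finset.sum_congr rfl fun i _ ↦ ?_
      rw [← TensorProduct.smul_tmul]
      congr 1
  · refine TMod.ext 𝔭 fun d ↦ ?_
    rw [map_sum, TMod.sum_toHom]
    simp only [TMod.ofTensor_tmul, Aad.ofEnd_toEnd]
    have key : ∀ z : X ⊗[R] LocQuot 𝔭,
        ∑ i, x i ⊗ₜ[R] TensorProduct.lid R (LocQuot 𝔭) ((l i).rTensor (LocQuot 𝔭) z) = z := by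
      intro z
      induction z using TensorProduct.induction_on with
      | zero => simp
      | add z w hz hw =>
        simp only [map_add, TensorProduct.tmul_add, Finset.sum_add_distrib, hz, hw]
      | tmul y e =>
        simp only [LinearMap.rTensor_tmul, TensorProduct.lid_tmul, ← TensorProduct.smul_tmul]
        rw [← TensorProduct.sum_tmul, hl]
    exact key _

variable {𝔭}

theorem ne_zero_of_primeCompl (s : 𝔭.primeCompl) : (s : R) ≠ 0 :=
  fun h ↦ s.2 (h ▸ 𝔭.zero_mem)

/-- In a domain c/s lies in R only if s divides c. So the annihilator of the class of 1/s is (s),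
and this class generates a copy of R/(s). -/
theorem LocQuot.frac_eq_zero_iff [IsDomain R] (c : R) (s : 𝔭.primeCompl) :
    c • LocQuot.frac 𝔭 1 s = 0 ↔ (s : R) ∣ c := by
  constructor
  · intro h
    rw [← LocQuot.frac_eq_smul, LocQuot.frac, Submodule.Quotient.mk_eq_zero] at h
    obtain ⟨a, ha⟩ := h
    rw [Algebra.linearMap_apply, ← Localization.mk_one_eq_algebraMap, Localization.mk_eq_mk_iff,
      Localization.r_iff_exists] at ha
    obtain ⟨u, hu⟩ := ha
    refine ⟨a, ?_⟩
    have := mul_left_cancel₀ (ne_zero_of_primeCompl u) hu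
    simpa using this.symm
  · rintro ⟨a, rfl⟩
    rw [mul_comm, mul_smul, LocQuot.smul_frac, smul_zero]

/-- Finitely many fractions have a common denominator, so no sums of tensors are needed. -/
theorem exists_tmul_frac (z : X ⊗[R] LocQuot 𝔭) : ∃ x s, z = x ⊗ₜ[R] LocQuot.frac 𝔭 1 s := by
  induction z using TensorProduct.induction_on with
  | zero => exact ⟨0, 1, (TensorProduct.zero_tmul _ _).symm⟩
  | tmul x d =>
    obtain ⟨c, s, rfl⟩ := d.exists_frac
    exact ⟨c • x, s, by rw [LocQuot.frac_eq_smul, TensorProduct.smul_tmul]⟩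
  | add z w hz hw =>
    obtain ⟨x, s, rfl⟩ := hz
    obtain ⟨y, t, rfl⟩ := hw
    refine ⟨(t : R) • x + (s : R) • y, s * t, ?_⟩
    rw [TensorProduct.add_tmul, TensorProduct.smul_tmul, TensorProduct.smul_tmul,
      LocQuot.frac_mul, mul_comm s t, LocQuot.frac_mul]

theorem exists_eq_smul_of_tmul_mk_one_eq_zero (s : R) (x : X)
    (h : x ⊗ₜ[R] (Submodule.Quotient.mk 1 : R ⧸ Ideal.span {s}) = 0) : ∃ y : X, x = s • y := by
  have h2 := TensorProduct.tensorQuotEquivQuotSMul_tmul_mk (Ideal.span {s}) x 1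
  rw [Ideal.Quotient.mk_eq_mk] at h
  rw [h, map_zero, one_smul, eq_comm, Submodule.Quotient.mk_eq_zero,
    Submodule.ideal_span_singleton_smul, Submodule.mem_smul_pointwise_iff_exists] at h2
  obtain ⟨y, -, hy⟩ := h2
  exact ⟨y, hy.symm⟩

/-- The map 1 ↦ 1/s embeds R/(s) into R_(𝔭)/R. By flatness X/sX = X ⊗ R/(s) embeds into X ⊗ R_(𝔭)/R,
so x vanishes modulo s. -/
theorem exists_eq_smul_of_tmul_frac_eq_zero [IsDomain R] [Module.Flat R X] (x : X)
    (s : 𝔭.primeCompl) (h : x ⊗ₜ[R] LocQuot.frac 𝔭 1 s = 0) : ∃ y : X, x = (s : R) • y := by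
  let i : (R ⧸ Ideal.span {(s : R)}) →ₗ[R] LocQuot 𝔭 :=
    (Ideal.span {(s : R)}).liftQ (LinearMap.toSpanSingleton R _ (LocQuot.frac 𝔭 1 s)) (by
      intro c hc
      rw [Ideal.mem_span_singleton] at hc
      rwa [LinearMap.mem_ker, LinearMap.toSpanSingleton_apply, LocQuot.frac_eq_zero_iff])
  have hi : Function.Injective i := by
    rw [injective_iff_map_eq_zero]
    intro c hc
    obtain ⟨c, rfl⟩ := Submodule.Quotient.mk_surjective _ c
    rw [Submodule.Quotient.mk_eq_zero, Ideal.mem_span_singleton, ← LocQuot.frac_eq_zero_iff (𝔭 := 𝔭)]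
    exact hc
  refine exists_eq_smul_of_tmul_mk_one_eq_zero (s : R) x ?_
  refine Module.Flat.lTensor_preserves_injective_linearMap (M := X) i hi ?_
  rw [map_zero, LinearMap.lTensor_tmul, ← h]
  congr 1
  exact (one_smul R (LocQuot.frac 𝔭 1 s)).symm ▸ rfl

/-- A sequence in `X` that is compatible with respect to a cofinal sequence of denominators
defines a homomorphism from `R_(𝔭) / R` to `X`. -/
theorem TMod.exists_of_sequence [IsDomain R] (s : ℕ → 𝔭.primeCompl) (u : ℕ → 𝔭.primeCompl)
    (hsu : ∀ n, s (n + 1) = s n * u n) (hcof : ∀ r : 𝔭.primeCompl, ∃ n, r ∣ s n)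
    (x : ℕ → X) (hx0 : ∀ n, (s n : R) • x n = 0) (hx : ∀ n, (u n : R) • x (n + 1) = x n) :
    ∃ t : TMod 𝔭 X, ∀ n, t.toHom 𝔭 (LocQuot.frac 𝔭 1 (s n)) = x n := by
  -- The modules generated by the classes of 1/s_n form an ascending chain with union R_(𝔭)/R. The
  -- relations between these generators are matched by those between the `x n`.
  have hle : ∀ n m, n ≤ m → ∃ v : R, LocQuot.frac 𝔭 1 (s n) = v • LocQuot.frac 𝔭 1 (s m) ∧
      x n = v • x m := by
    intro n m hnm
    induction m, hnm using Nat.le_induction with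
    | base => exact ⟨1, (one_smul _ _).symm, (one_smul _ _).symm⟩
    | succ m _ ih =>
      obtain ⟨v, h1, h2⟩ := ih
      exact ⟨v * u m, by rw [h1, hsu, mul_smul, LocQuot.frac_mul], by rw [h2, mul_smul, hx]⟩
  have hex : ∀ d : LocQuot 𝔭, ∃ (c : R) (n : ℕ), d = c • LocQuot.frac 𝔭 1 (s n) := fun d ↦ by
    obtain ⟨c, r, rfl⟩ := d.exists_frac
    obtain ⟨n, q, hq⟩ := hcof r
    exact ⟨c * q, n, by rw [hq, mul_smul, LocQuot.frac_mul, LocQuot.frac_eq_smul]⟩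
  have hup : ∀ (c : R) (n N : ℕ), n ≤ N → ∃ c' : R,
      c • LocQuot.frac 𝔭 1 (s n) = c' • LocQuot.frac 𝔭 1 (s N) ∧ c • x n = c' • x N := by
    intro c n N h
    obtain ⟨v, h1, h2⟩ := hle n N h
    exact ⟨c * v, by rw [h1, mul_smul], by rw [h2, mul_smul]⟩
  -- The annihilator of 1/s_N is (s_N), which kills `x N` by `hx0`. Two representations with
  -- different indices are first moved to the larger one.
  have hsame : ∀ (c c' : R) (N : ℕ), c • LocQuot.frac 𝔭 1 (s N) = c' • LocQuot.frac 𝔭 1 (s N) →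
      c • x N = c' • x N := by
    intro c c' N h
    rw [← sub_eq_zero, ← sub_smul, LocQuot.frac_eq_zero_iff] at h
    obtain ⟨b, hb⟩ := h
    rw [← sub_eq_zero, ← sub_smul, hb, mul_comm, mul_smul, hx0, smul_zero]
  have hwd : ∀ (c c' : R) (n m : ℕ), c • LocQuot.frac 𝔭 1 (s n) = c' • LocQuot.frac 𝔭 1 (s m) →
      c • x n = c' • x m := by
    intro c c' n m h
    obtain ⟨a, h1, h2⟩ := hup c n (max n m) (le_max_left _ _)
    obtain ⟨a', h1', h2'⟩ := hup c' m (max n m) (le_max_right _ _)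
    rw [h2, h2']
    exact hsame _ _ _ (by rw [← h1, ← h1', h])
  choose c n hcn using hex
  have hval : ∀ d a m, d = a • LocQuot.frac 𝔭 1 (s m) → c d • x (n d) = a • x m :=
    fun d a m h ↦ hwd _ _ _ _ ((hcn d).symm.trans h)
  let t : LocQuot 𝔭 →ₗ[R] X :=
    { toFun := fun d ↦ c d • x (n d)
      map_add' := fun d d' ↦ by
        obtain ⟨a, h1, h2⟩ := hup (c d) (n d) (max (n d) (n d')) (le_max_left _ _)
        obtain ⟨a', h1', h2'⟩ := hup (c d') (n d') (max (n d) (n d')) (le_max_right _ _)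
        rw [h2, h2', ← add_smul]
        refine hval _ _ _ ?_
        rw [add_smul, ← h1, ← h1', ← hcn, ← hcn]
      map_smul' := fun r d ↦ by
        rw [RingHom.id_apply, ← mul_smul]
        refine hval _ _ _ ?_
        rw [mul_smul, ← hcn] }
  exact ⟨t, fun m ↦ (hval _ 1 m (one_smul _ _).symm).trans (one_smul _ _)⟩

/-- A Mittag-Leffler argument: by countability a homomorphism out of R_(𝔭)/R is a compatible
sequence, and divisibility of the kernel of `h` allows each new lift to be corrected so that it is
compatible with the previous one. -/
theorem TMod.map_surjective [IsDomain R] [Countable R] (h : X →ₗ[R] Y)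
    (hsurj : Function.Surjective h)
    (hdiv : ∀ s ∉ 𝔭, ∀ w, h w = 0 → ∃ w', h w' = 0 ∧ s • w' = w) :
    Function.Surjective (TMod.map 𝔭 h) := by
  intro τ
  obtain ⟨u, hu⟩ := exists_surjective_nat 𝔭.primeCompl
  -- Partial products of an enumeration of all denominators are cofinal for divisibility.
  let s : ℕ → 𝔭.primeCompl := fun n ↦ ∏ i ∈ Finset.range n, u i
  have hsu : ∀ n, s (n + 1) = s n * u n := fun n ↦ Finset.prod_range_succ _ _
  let y : ℕ → Y := fun n ↦ τ.toHom 𝔭 (LocQuot.frac 𝔭 1 (s n))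
  have hy : ∀ n, (u n : R) • y (n + 1) = y n := fun n ↦ by
    rw [← map_smul, hsu, LocQuot.frac_mul]
  have hstep : ∀ n x, h x = y n → ∃ x', h x' = y (n + 1) ∧ (u n : R) • x' = x := by
    intro n x hx
    obtain ⟨x', hx'⟩ := hsurj (y (n + 1))
    obtain ⟨w, hw, hw'⟩ := hdiv (u n) (u n).2 ((u n : R) • x' - x) (by
      rw [map_sub, map_smul, hx', hx, hy, sub_self])
    exact ⟨x' - w, by rw [map_sub, hw, sub_zero, hx'], by rw [smul_sub, hw', sub_sub_cancel]⟩
  -- `s 0` is the empty product 1, and 1/1 is zero in R_(𝔭)/R, so the lifting may start at 0.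
  have h0 : h 0 = y 0 := by
    have := LocQuot.smul_frac (1 : 𝔭.primeCompl)
    rw [OneMemClass.coe_one, one_smul] at this
    change h 0 = τ.toHom 𝔭 (LocQuot.frac 𝔭 1 1)
    rw [this, map_zero, map_zero]
  choose! next hnext1 hnext2 using hstep
  let x : ℕ → X := fun n ↦ Nat.rec 0 (fun n x ↦ next n x) n
  have hxy : ∀ n, h (x n) = y n := fun n ↦ by
    induction n with
    | zero => exact h0
    | succ n ih => exact hnext1 n _ ih
  have hx : ∀ n, (u n : R) • x (n + 1) = x n := fun n ↦ hnext2 n _ (hxy n)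
  have hx0 : ∀ n, (s n : R) • x n = 0 := fun n ↦ by
    induction n with
    | zero => exact smul_zero _
    | succ n ih => rw [hsu, Submonoid.coe_mul, mul_smul, hx, ih]
  have hcof : ∀ r : 𝔭.primeCompl, ∃ n, r ∣ s n := fun r ↦ by
    obtain ⟨n, rfl⟩ := hu r
    exact ⟨n + 1, s n, by rw [hsu, mul_comm]⟩
  obtain ⟨t, ht⟩ := TMod.exists_of_sequence s u hsu hcof x hx0 hx
  refine ⟨t, TMod.ext 𝔭 fun d ↦ ?_⟩
  obtain ⟨c, r, rfl⟩ := d.exists_frac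
  obtain ⟨n, q, hq⟩ := hcof r
  have : LocQuot.frac 𝔭 c r = (c * q : R) • LocQuot.frac 𝔭 1 (s n) := by
    rw [hq, mul_smul, LocQuot.frac_mul, LocQuot.frac_eq_smul]
  rw [this, map_smul, map_smul, TMod.map_toHom, ht, hxy]

end Sequence

/-! ### Exactness of the extended Tate module sequence -/

section Exact

variable {R : Type*} [CommRing R] {𝔭 : Ideal R} [𝔭.IsPrime]
variable {N : Type*} [AddCommGroup N] [Module R N] (M : Submodule R N)

theorem tateProj_eq (h : Function.Bijective (TMod.ofTensor 𝔭 M)) (t : TMod 𝔭 (DivQuot 𝔭 M)) :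
    TMod.ofTensor 𝔭 M (tateProj 𝔭 M t) = TMod.map 𝔭 (divQuotToTensor 𝔭 M) t := by
  rw [tateProj, dif_pos h]
  exact (LinearEquiv.ofBijective _ h).apply_symm_apply _

theorem divQuotToTensor_mk (x : Div 𝔭 M) (a : 𝔭.primeCompl) (ha : (a : R) • x.1 ∈ M) :
    divQuotToTensor 𝔭 M (Submodule.Quotient.mk x) =
      (⟨(a : R) • x.1, ha⟩ : M) ⊗ₜ[R] LocQuot.frac 𝔭 1 a :=
  divToTensorFun_eq 𝔭 M x a ha

theorem torsionToDivQuot_injective [IsDomain R] [Module.IsTorsionFree R M] :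
    Function.Injective (torsionToDivQuot 𝔭 M) := by
  rw [injective_iff_map_eq_zero]
  rintro ⟨x, a, ha, hx⟩ h
  have hxM : x ∈ M := (Submodule.Quotient.mk_eq_zero (M.submoduleOf (Div 𝔭 M))).1 h
  rw [Submodule.mem_bot] at hx
  have ha0 : a ≠ 0 := fun h0 ↦ ha (h0 ▸ 𝔭.zero_mem)
  have : a • (⟨x, hxM⟩ : M) = 0 := Subtype.ext hx
  have := (smul_eq_zero.1 this).resolve_left ha0
  exact Subtype.ext (show x = 0 from congrArg Subtype.val this)

/-- If (a x) ⊗ 1/a = 0, flatness gives a x = a m with m in M. Then x - m is torsion and has the same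
class as x modulo M. -/
theorem divQuotToTensor_eq_zero_iff [IsDomain R] [Module.Flat R M] (x : DivQuot 𝔭 M) :
    divQuotToTensor 𝔭 M x = 0 ↔ x ∈ LinearMap.range (torsionToDivQuot 𝔭 M) := by
  constructor
  · intro h
    obtain ⟨⟨x, a, ha, hx⟩, rfl⟩ := Submodule.Quotient.mk_surjective _ x
    rw [divQuotToTensor_mk M _ ⟨a, ha⟩ hx] at h
    obtain ⟨m, hm⟩ := exists_eq_smul_of_tmul_frac_eq_zero _ _ h
    have hm' : a • x = a • m.1 := congrArg Subtype.val hm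
    refine ⟨⟨x - m.1, a, ha, by rw [Submodule.mem_bot, smul_sub, hm', sub_self]⟩, ?_⟩
    refine (Submodule.Quotient.eq _).2 ?_
    change (x - m.1) - x ∈ M
    rw [sub_sub_cancel_left]
    exact M.neg_mem m.2
  · rintro ⟨⟨x, a, ha, hx⟩, rfl⟩
    have hx0 : a • x = 0 := hx
    have hxM : a • x ∈ M := hx0 ▸ M.zero_mem
    refine (divQuotToTensor_mk M ⟨x, a, ha, hxM⟩ ⟨a, ha⟩ hxM).trans ?_
    rw [show (⟨a • x, hxM⟩ : M) = 0 from Subtype.ext hx0, TensorProduct.zero_tmul]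

/-- Every element is m ⊗ 1/s, and a solution x of s x = m is a preimage. -/
theorem divQuotToTensor_surjective (hN : ∀ s ∉ 𝔭, ∀ y : N, ∃ x : N, s • x = y) :
    Function.Surjective (divQuotToTensor 𝔭 M) := by
  intro z
  obtain ⟨m, s, rfl⟩ := exists_tmul_frac z
  obtain ⟨x, hx⟩ := hN s s.2 m.1
  have hxM : (s : R) • x ∈ M := by rw [hx]; exact m.2
  refine ⟨Submodule.Quotient.mk ⟨x, s, s.2, hxM⟩, ?_⟩
  rw [divQuotToTensor_mk M _ s hxM]
  congr 1
  exact Subtype.ext hx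

/-- The extended Tate module sequence of a finitely generated projective submodule `M` of a
prime-to-`𝔭` divisible module is exact. -/
theorem tateSequenceExact [IsDomain R] [Countable R] [Module.Finite R M] [Module.Projective R M]
    (hN : ∀ s ∉ 𝔭, ∀ y : N, ∃ x : N, s • x = y) : TateSequenceExact 𝔭 M where
  ofTensor_bijective := TMod.ofTensor_bijective 𝔭
  injective := fun t u h ↦ TMod.ext 𝔭 fun d ↦ torsionToDivQuot_injective M <|
    congrArg (fun v ↦ TMod.toHom 𝔭 v d) h
  exact := fun t ↦ by
    have hb := TMod.ofTensor_bijective 𝔭 (X := M)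
    rw [← map_eq_zero_iff _ hb.1, tateProj_eq M hb]
    constructor
    · intro h
      have hr : ∀ d, t.toHom 𝔭 d ∈ LinearMap.range (torsionToDivQuot 𝔭 M) := fun d ↦
        (divQuotToTensor_eq_zero_iff M _).1 (congrArg (fun v ↦ TMod.toHom 𝔭 v d) h)
      refine ⟨((LinearEquiv.ofInjective _ (torsionToDivQuot_injective M)).symm.toLinearMap.comp
        ((t.toHom 𝔭).codRestrict _ hr) : LocQuot 𝔭 →ₗ[R] _), TMod.ext 𝔭 fun d ↦ ?_⟩
      exact congrArg Subtype.val ((LinearEquiv.ofInjective _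
        (torsionToDivQuot_injective M)).apply_symm_apply ⟨t.toHom 𝔭 d, hr d⟩)
    · rintro ⟨t, rfl⟩
      exact TMod.ext 𝔭 fun d ↦ (divQuotToTensor_eq_zero_iff M _).2 ⟨t.toHom 𝔭 d, rfl⟩
  surjective := fun z ↦ by
    have hb := TMod.ofTensor_bijective 𝔭 (X := M)
    obtain ⟨t, ht⟩ := TMod.map_surjective (divQuotToTensor 𝔭 M) (divQuotToTensor_surjective M hN)
      (fun s hs w hw ↦ by
        -- The kernel is the image of Div(0), which inherits divisibility from `N`.
        obtain ⟨⟨x, a, ha, hx⟩, rfl⟩ := (divQuotToTensor_eq_zero_iff M w).1 hw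
        obtain ⟨y, hy⟩ := hN s hs x
        have hyd : y ∈ Div 𝔭 (⊥ : Submodule R N) :=
          ⟨a * s, 𝔭.primeCompl.mul_mem ha hs, by rw [mul_smul, hy]; exact hx⟩
        refine ⟨torsionToDivQuot 𝔭 M ⟨y, hyd⟩, (divQuotToTensor_eq_zero_iff M _).2 ⟨_, rfl⟩, ?_⟩
        rw [← map_smul]
        congr 1
        exact Subtype.ext hy) (TMod.ofTensor 𝔭 M z)
    exact ⟨t, hb.1 (by rw [tateProj_eq M hb, ht])⟩

end Exact

end DrinfeldTate

namespace DrinfeldTate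

/-! ### Base change along a surjective ring homomorphism -/

section BaseChange

/-- A surjective semilinear map along a surjective ring homomorphism `π` is a base change if every
element of its kernel is a multiple by an element of the kernel of `π`. -/
theorem isBaseChangeAlong_of_surjective {R S X Y : Type*} [CommRing R] [CommRing S] (π : R →+* S)
    [AddCommGroup X] [Module R X] [AddCommGroup Y] (modY : Module S Y) (v : X →+ Y)
    (hv : ∀ (r : R) (x : X), v (r • x) = π r • v x) (hπ : Function.Surjective π)
    (hsurj : Function.Surjective v)
    (hker : ∀ x, v x = 0 → ∃ r x', π r = 0 ∧ x = r • x') : IsBaseChangeAlong π modY v := by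
  refine ⟨hv, ?_⟩
  let _ : Algebra R S := π.toAlgebra
  let _ : Module R Y := Module.compHom Y π
  have : IsScalarTower R S Y := ⟨fun r s y ↦ mul_smul (π r) s y⟩
  let f : X →ₗ[R] Y := { toFun := v, map_add' := map_add v, map_smul' := hv }
  -- Since π is surjective, scalars of `S` move to the right factor. An element 1 ⊗ (r x') with π r
  -- = 0 then moves back to zero.
  have hone : ∀ z : S ⊗[R] X, ∃ x : X, z = 1 ⊗ₜ x := by
    intro z
    induction z using TensorProduct.induction_on with
    | zero => exact ⟨0, (TensorProduct.tmul_zero _ _).symm⟩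
    | add z w hz hw =>
      obtain ⟨x, rfl⟩ := hz
      obtain ⟨y, rfl⟩ := hw
      exact ⟨x + y, (TensorProduct.tmul_add _ _ _).symm⟩
    | tmul s x =>
      obtain ⟨r, rfl⟩ := hπ s
      refine ⟨r • x, ?_⟩
      rw [← TensorProduct.smul_tmul, Algebra.smul_def, mul_one]
      rfl
  have hlift : ∀ x : X, TensorProduct.lift
      ((Algebra.linearMap S <| Module.End S (X →ₗ[R] Y)).flip f |>.restrictScalars R)
      ((1 : S) ⊗ₜ[R] x) = v x := fun x ↦ by
    rw [TensorProduct.lift.tmul]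
    exact one_smul S (v x)
  refine ⟨?_, fun y ↦ ?_⟩
  · rw [injective_iff_map_eq_zero]
    intro z hz
    obtain ⟨x, rfl⟩ := hone z
    obtain ⟨r, x', hr, rfl⟩ := hker x ((hlift x).symm.trans hz)
    rw [← TensorProduct.smul_tmul, Algebra.smul_def, mul_one]
    change π r ⊗ₜ[R] x' = 0
    rw [hr, TensorProduct.zero_tmul]
  · obtain ⟨x, rfl⟩ := hsurj y
    exact ⟨1 ⊗ₜ x, hlift x⟩

end BaseChange

variable {B A : Type*} [CommRing B] [CommRing A] [Algebra B A]
variable (𝔮 : Ideal B) [𝔮.IsPrime] (𝔭 : Ideal A) [𝔭.IsPrime]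
variable (h𝔮 : 𝔮 = 𝔭.comap (algebraMap B A))

/-! ### Comparison of B_(𝔮)/B with A_(𝔭)/A -/

section Extend

variable {Z X : Type*} [AddCommGroup Z] [Module B Z] [AddCommGroup X] [Module A X]

/-- The `A`-linear extension `A ⊗_B Z → X` of a `B`-linear map `Z → X`. -/
def extendLinear (g : Z →ₛₗ[algebraMap B A] X) : A ⊗[B] Z →ₗ[A] X where
  toFun := TensorProduct.liftAddHom
    { toFun := fun a ↦ (DistribSMul.toAddMonoidHom X a).comp g.toAddMonoidHom
      map_zero' := AddMonoidHom.ext fun d ↦ zero_smul A _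
      map_add' := fun a b ↦ AddMonoidHom.ext fun d ↦ add_smul a b _ }
    (fun b a d ↦ by
      change (b • a) • g d = a • g (b • d)
      rw [map_smulₛₗ, Algebra.smul_def, mul_comm, mul_smul])
  map_add' := map_add _
  map_smul' a z := by
    induction z using TensorProduct.induction_on with
    | zero => rw [smul_zero, map_zero, smul_zero]
    | add z w hz hw => rw [smul_add, map_add, hz, hw, map_add, smul_add]
    | tmul b d => exact mul_smul a b (g d)

theorem extendLinear_tmul (g : Z →ₛₗ[algebraMap B A] X) (a : A) (d : Z) :
    extendLinear g (a ⊗ₜ d) = a • g d := rfl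

end Extend

section TensorLoc

variable (X : Type*) [AddCommGroup X] [Module B X] [Module A X] [IsScalarTower B A X]

/-- The natural map `X ⊗_B B_(𝔮) / B → X ⊗_A A_(𝔭) / A`. -/
def tensorLocMap : X ⊗[B] LocQuot 𝔮 →+ X ⊗[A] LocQuot 𝔭 :=
  TensorProduct.liftAddHom
    { toFun := fun x ↦ (TensorProduct.mk A X (LocQuot 𝔭) x).toAddMonoidHom.comp
        (locQuotMap 𝔮 𝔭 h𝔮).toAddMonoidHom
      map_zero' := AddMonoidHom.ext fun d ↦ TensorProduct.zero_tmul _ _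
      map_add' := fun x y ↦ AddMonoidHom.ext fun d ↦ TensorProduct.add_tmul x y _ }
    (fun b x d ↦ by
      change (b • x) ⊗ₜ[A] locQuotMap 𝔮 𝔭 h𝔮 d = x ⊗ₜ[A] locQuotMap 𝔮 𝔭 h𝔮 (b • d)
      rw [map_smulₛₗ, ← TensorProduct.smul_tmul, algebraMap_smul])

variable {X} in
theorem tensorLocMap_tmul (x : X) (d : LocQuot 𝔮) :
    tensorLocMap 𝔮 𝔭 h𝔮 X (x ⊗ₜ d) = x ⊗ₜ locQuotMap 𝔮 𝔭 h𝔮 d := rfl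

/-- An element of the source is x ⊗ 1/s with s in B. If its image vanishes, flatness over A makes x
a multiple of s, and this already kills x ⊗ 1/s over B. -/
theorem tensorLocMap_injective [IsDomain A] [Module.Flat A X] :
    Function.Injective (tensorLocMap 𝔮 𝔭 h𝔮 X) := by
  rw [injective_iff_map_eq_zero]
  intro z hz
  obtain ⟨x, s, rfl⟩ := exists_tmul_frac z
  rw [tensorLocMap_tmul, locQuotMap_frac, map_one] at hz
  obtain ⟨y, rfl⟩ := exists_eq_smul_of_tmul_frac_eq_zero _ _ hz
  rw [algebraMap_smul, TensorProduct.smul_tmul, LocQuot.smul_frac, TensorProduct.tmul_zero]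

end TensorLoc

/-! ### The ring A ⊗_B B_ad and the natural map π -/

section Scalar

/-- The natural map `A ⊗_B B_(𝔮) / B → A_(𝔭) / A`. -/
abbrev locQuotExtend : A ⊗[B] LocQuot 𝔮 →ₗ[A] LocQuot 𝔭 := extendLinear (locQuotMap 𝔮 𝔭 h𝔮)

theorem lid_tensorLocMap (z : A ⊗[B] LocQuot 𝔮) :
    TensorProduct.lid A (LocQuot 𝔭) (tensorLocMap 𝔮 𝔭 h𝔮 A z) = locQuotExtend 𝔮 𝔭 h𝔮 z := by
  induction z using TensorProduct.induction_on with
  | zero => simp only [map_zero]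
  | add z w hz hw => simp only [map_add, hz, hw]
  | tmul a d => rfl

theorem locQuotExtend_injective [IsDomain A] : Function.Injective (locQuotExtend 𝔮 𝔭 h𝔮) := by
  intro z w h
  rw [← lid_tensorLocMap, ← lid_tensorLocMap] at h
  exact tensorLocMap_injective 𝔮 𝔭 h𝔮 A ((TensorProduct.lid A (LocQuot 𝔭)).injective h)

/-- An element killed by b has the form a • (1/b), and 1/b comes from B_(𝔮)/B. This describes the
image of the embedded module A ⊗_B B_(𝔮)/B as the prime-to-𝔮 torsion. -/
theorem exists_locQuotExtend_eq_iff (y : LocQuot 𝔭) :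
    (∃ b ∉ 𝔮, algebraMap B A b • y = 0) ↔ ∃ z, locQuotExtend 𝔮 𝔭 h𝔮 z = y := by
  constructor
  · rintro ⟨b, hb, hy⟩
    obtain ⟨a, rfl⟩ := LocQuot.of_smul_eq_zero ⟨_, not_mem_of_comap 𝔮 𝔭 h𝔮 hb⟩ y hy
    refine ⟨a ⊗ₜ LocQuot.frac 𝔮 1 ⟨b, hb⟩, ?_⟩
    rw [extendLinear_tmul, locQuotMap_frac, map_one]
  · rintro ⟨z, rfl⟩
    obtain ⟨a, s, rfl⟩ := exists_tmul_frac z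
    refine ⟨s, s.2, ?_⟩
    rw [← map_smul, algebraMap_smul, TensorProduct.smul_tmul', TensorProduct.smul_tmul,
      LocQuot.smul_frac, TensorProduct.tmul_zero, map_zero]

/-- `A ⊗_B B_(𝔮) / B → A_(𝔭) / A` as a map that is semilinear over `B → A`. -/
def locQuotExtendₛₗ : A ⊗[B] LocQuot 𝔮 →ₛₗ[algebraMap B A] LocQuot 𝔭 where
  toFun := locQuotExtend 𝔮 𝔭 h𝔮
  map_add' := map_add _
  map_smul' b z := by rw [← map_smul, algebraMap_smul]

theorem tensorToHom_tmul (a : A) (g : Aad 𝔮) (d : LocQuot 𝔮) :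
    tensorToHom 𝔮 𝔭 h𝔮 (a ⊗ₜ g) d = a • locQuotMap 𝔮 𝔭 h𝔮 (g.toEnd 𝔮 d) := rfl

/-- Factors `tensorToHom` into the natural map of `TMod.ofTensor` for the B-module A, bijective if A
is finite projective, and the embedding into A_(𝔭)/A. -/
theorem tensorToHom_eq (z : A ⊗[B] Aad 𝔮) (d : LocQuot 𝔮) :
    tensorToHom 𝔮 𝔭 h𝔮 z d = locQuotExtend 𝔮 𝔭 h𝔮
      ((TMod.ofTensor 𝔮 A (TensorProduct.comm B A (Aad 𝔮) z)).toHom 𝔮 d) := by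
  induction z using TensorProduct.induction_on with
  | zero => simp only [map_zero, TMod.zero_toHom, AddMonoidHom.zero_apply]
  | add z w hz hw => simp only [map_add, TMod.add_toHom, AddMonoidHom.add_apply, hz, hw]
  | tmul a g => rfl

theorem tensorToHom_ext [IsDomain A] [Module.Finite B A] [Module.Projective B A]
    {z w : A ⊗[B] Aad 𝔮} (h : ∀ d, tensorToHom 𝔮 𝔭 h𝔮 z d = tensorToHom 𝔮 𝔭 h𝔮 w d) : z = w := by
  refine (TensorProduct.comm B A (Aad 𝔮)).injective
    ((TMod.ofTensor_bijective 𝔮 (X := A)).1 (TMod.ext 𝔮 fun d ↦ ?_))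
  refine locQuotExtend_injective 𝔮 𝔭 h𝔮 ?_
  rw [← tensorToHom_eq, ← tensorToHom_eq, h]

/-- The restriction of f to B_(𝔮)/B takes values in prime-to-𝔮 torsion, that is, in A ⊗_B B_(𝔮)/B.
Projectivity of A over B turns such a homomorphism into an element of A ⊗_B B_ad. -/
theorem exists_tensorToHom [IsDomain A] [Module.Finite B A] [Module.Projective B A] (f : Aad 𝔭) :
    ∃ z : A ⊗[B] Aad 𝔮, ∀ d, tensorToHom 𝔮 𝔭 h𝔮 z d = f.toEnd 𝔭 (locQuotMap 𝔮 𝔭 h𝔮 d) := by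
  have hj : ∀ y : LocQuot 𝔭, (∃ b ∉ 𝔮, algebraMap B A b • y = 0) →
      ∃ z, locQuotExtendₛₗ 𝔮 𝔭 h𝔮 z = y := fun y ↦ (exists_locQuotExtend_eq_iff 𝔮 𝔭 h𝔮 y).1
  have hinj : Function.Injective (locQuotExtendₛₗ 𝔮 𝔭 h𝔮) := locQuotExtend_injective 𝔮 𝔭 h𝔮
  let t := TMod.res 𝔮 𝔭 h𝔮 (locQuotExtendₛₗ 𝔮 𝔭 h𝔮) hinj hj (TMod.ofHom 𝔭 (f.toEnd 𝔭))
  obtain ⟨w, hw⟩ := (TMod.ofTensor_bijective 𝔮 (X := A)).2 t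
  refine ⟨(TensorProduct.comm B A (Aad 𝔮)).symm w, fun d ↦ ?_⟩
  rw [tensorToHom_eq, LinearEquiv.apply_symm_apply, hw]
  exact TMod.res_spec 𝔮 𝔭 h𝔮 (locQuotExtendₛₗ 𝔮 𝔭 h𝔮) hinj hj (TMod.ofHom 𝔭 (f.toEnd 𝔭)) d

theorem tensorToHom_mul_tmul (z : A ⊗[B] Aad 𝔮) (b : A) (h : Aad 𝔮) (d : LocQuot 𝔮) :
    tensorToHom 𝔮 𝔭 h𝔮 (z * b ⊗ₜ h) d = b • tensorToHom 𝔮 𝔭 h𝔮 z (h.toEnd 𝔮 d) := by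
  induction z using TensorProduct.induction_on with
  | zero => rw [zero_mul, map_zero, AddMonoidHom.zero_apply, AddMonoidHom.zero_apply, smul_zero]
  | add z w hz hw =>
    rw [add_mul, map_add, map_add, AddMonoidHom.add_apply, AddMonoidHom.add_apply, hz, hw, smul_add]
  | tmul a g =>
    rw [Algebra.TensorProduct.tmul_mul_tmul, tensorToHom_tmul, tensorToHom_tmul, mul_comm a b,
      mul_smul]
    rfl

theorem tensorToHom_mul (z : A ⊗[B] Aad 𝔮) (f : Aad 𝔭)
    (hf : ∀ d, tensorToHom 𝔮 𝔭 h𝔮 z d = f.toEnd 𝔭 (locQuotMap 𝔮 𝔭 h𝔮 d))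
    (w : A ⊗[B] Aad 𝔮) (d : LocQuot 𝔮) :
    tensorToHom 𝔮 𝔭 h𝔮 (z * w) d = f.toEnd 𝔭 (tensorToHom 𝔮 𝔭 h𝔮 w d) := by
  induction w using TensorProduct.induction_on with
  | zero => rw [mul_zero, map_zero, AddMonoidHom.zero_apply, map_zero]
  | add w w' hw hw' =>
    rw [mul_add, map_add, map_add, AddMonoidHom.add_apply, AddMonoidHom.add_apply, hw, hw', map_add]
  | tmul b h => rw [tensorToHom_mul_tmul, hf, tensorToHom_tmul, map_smul]

/-- The natural map `A_ad → A ⊗_B B_ad` exists and is unique. -/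
theorem exists_unique_isNaturalMap [IsDomain A] [Module.Finite B A] [Module.Projective B A] :
    ∃ π : Aad 𝔭 →ₐ[A] A ⊗[B] Aad 𝔮, IsNaturalMap 𝔮 𝔭 h𝔮 π ∧
      ∀ π' : Aad 𝔭 →ₐ[A] A ⊗[B] Aad 𝔮, IsNaturalMap 𝔮 𝔭 h𝔮 π' → π' = π := by
  -- By `tensorToHom_ext` an element of A ⊗_B B_ad is determined by its homomorphism. All laws for
  -- π, and its uniqueness, are therefore checked on restrictions.
  choose π hπ using exists_tensorToHom 𝔮 𝔭 h𝔮
  have hC : ∀ a : A, π (algebraMap A (Aad 𝔭) a) = algebraMap A (A ⊗[B] Aad 𝔮) a := fun a ↦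
    tensorToHom_ext 𝔮 𝔭 h𝔮 fun d ↦ hπ _ d
  refine ⟨{ toFun := π, map_one' := ?_, map_mul' := fun f g ↦ ?_, map_zero' := ?_,
            map_add' := fun f g ↦ ?_, commutes' := hC }, hπ, fun π' h' ↦ ?_⟩
  · simpa only [map_one] using hC 1
  · refine tensorToHom_ext 𝔮 𝔭 h𝔮 fun d ↦ ?_
    rw [tensorToHom_mul 𝔮 𝔭 h𝔮 (π f) f (hπ f), hπ, hπ]
    rfl
  · simpa only [map_zero] using hC 0
  · refine tensorToHom_ext 𝔮 𝔭 h𝔮 fun d ↦ ?_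
    rw [map_add, AddMonoidHom.add_apply, hπ, hπ, hπ]
    rfl
  · refine AlgHom.ext fun f ↦ tensorToHom_ext 𝔮 𝔭 h𝔮 fun d ↦ ?_
    rw [h']
    exact (hπ f d).symm

end Scalar

/-! ### The prime-to-𝔮 torsion as a direct summand -/

section Projection

/-- `e` is a projection of `A_(𝔭) / A` onto its prime-to-`𝔮` torsion. -/
structure IsTorsionProjection (e : Aad 𝔭) : Prop where
  mem : ∀ y, ∃ b ∉ 𝔮, algebraMap B A b • e.toEnd 𝔭 y = 0
  eq_self : ∀ y, (∃ b ∉ 𝔮, algebraMap B A b • y = 0) → e.toEnd 𝔭 y = y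

-- By integrality each denominator s in A divides a nonzero element of B.
variable (B) in
theorem LocQuot.exists_algebraMap_smul_eq_zero [IsDomain A] [IsDomain B] [Algebra.IsIntegral B A]
    (y : LocQuot 𝔭) : ∃ β : B, β ≠ 0 ∧ algebraMap B A β • y = 0 := by
  obtain ⟨c, s, rfl⟩ := y.exists_frac
  obtain ⟨β, hβ, v, hv⟩ := (Algebra.IsIntegral.isIntegral (R := B) (s : A)).isAlgebraic
    |>.exists_nonzero_dvd (mem_nonZeroDivisors_of_ne_zero (ne_zero_of_primeCompl s))
  refine ⟨β, hβ, ?_⟩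
  rw [hv, mul_comm, mul_smul, LocQuot.frac_eq_smul, smul_comm (s : A), LocQuot.smul_frac, smul_zero,
    smul_zero]

variable (A) in
/-- The submodule of all elements annihilated by an element of `B` outside `𝔮`. -/
def coprimeTorsion (Y : Type*) [AddCommGroup Y] [Module A Y] : Submodule A Y where
  carrier := {y | ∃ b ∉ 𝔮, algebraMap B A b • y = 0}
  zero_mem' := ⟨1, 𝔮.primeCompl.one_mem, smul_zero _⟩
  add_mem' := by
    rintro x y ⟨a, ha, hx⟩ ⟨b, hb, hy⟩
    refine ⟨a * b, 𝔮.primeCompl.mul_mem ha hb, ?_⟩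
    rw [map_mul, smul_add, mul_smul _ _ y, hy, mul_comm, mul_smul, hx, smul_zero, smul_zero,
      add_zero]
  smul_mem' := by
    rintro c x ⟨b, hb, hx⟩
    exact ⟨b, hb, by rw [smul_comm, hx, smul_zero]⟩

variable (A) in
/-- The submodule of all elements annihilated by a power of `𝔮`. -/
def primaryTorsion (Y : Type*) [AddCommGroup Y] [Module A Y] : Submodule A Y where
  carrier := {y | ∃ n, ∀ b ∈ 𝔮 ^ n, algebraMap B A b • y = 0}
  zero_mem' := ⟨0, fun _ _ ↦ smul_zero _⟩
  add_mem' := by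
    rintro x y ⟨n, hx⟩ ⟨m, hy⟩
    refine ⟨max n m, fun b hb ↦ ?_⟩
    rw [smul_add, hx b (Ideal.pow_le_pow_right (le_max_left _ _) hb),
      hy b (Ideal.pow_le_pow_right (le_max_right _ _) hb), add_zero]
  smul_mem' := by
    rintro c x ⟨n, hx⟩
    exact ⟨n, fun b hb ↦ by rw [smul_comm, hx b hb, smul_zero]⟩

/-- The primary decomposition of a torsion module over a Dedekind domain, with all primes other than
𝔮 taken together. -/
theorem isCompl_coprimeTorsion [IsDedekindDomain B] (h0 : 𝔮 ≠ ⊥) (Y : Type*) [AddCommGroup Y]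
    [Module A Y] (hY : ∀ y : Y, ∃ β : B, β ≠ 0 ∧ algebraMap B A β • y = 0) :
    IsCompl (coprimeTorsion A 𝔮 Y) (primaryTorsion A 𝔮 Y) := by
  have hmax : 𝔮.IsMaximal := Ideal.IsPrime.isMaximal inferInstance h0
  have hcop : ∀ (J : Ideal B) (n : ℕ), ¬ J ≤ 𝔮 → ∃ j ∈ J, ∃ k ∈ 𝔮 ^ n, j + k = 1 := by
    intro J n hJ
    have : IsCoprime J (𝔮 ^ n) := by
      refine IsCoprime.pow_right ?_
      rw [Ideal.isCoprime_iff_sup_eq, sup_comm]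
      by_contra h
      exact hJ (le_sup_right.trans (hmax.eq_of_le h le_sup_left).ge)
    exact Ideal.isCoprime_iff_exists.1 this
  have hdec : ∀ (y : Y) (j k : B), j + k = 1 →
      y = algebraMap B A k • y + algebraMap B A j • y := fun y j k h ↦ by
    rw [← add_smul, ← map_add, add_comm, h, map_one, one_smul]
  constructor
  · rw [Submodule.disjoint_def]
    rintro y ⟨b, hb, hy⟩ ⟨n, hn⟩
    obtain ⟨j, hj, k, hk, h⟩ := hcop (Ideal.span {b}) n
      (fun h ↦ hb (h (Ideal.mem_span_singleton_self b)))
    obtain ⟨c, rfl⟩ := Ideal.mem_span_singleton'.1 hj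
    rw [hdec y _ _ h, hn k hk, map_mul, mul_smul, hy, smul_zero, add_zero]
  · rw [codisjoint_iff, eq_top_iff]
    rintro y -
    obtain ⟨β, hβ, hy⟩ := hY y
    -- Factor (β) = 𝔮^n J with J not contained in 𝔮. As 𝔮 is maximal, 1 = j + k with j in J and k in
    -- 𝔮^n; then k y is prime-to-𝔮 torsion and j y is 𝔮-primary.
    have hfin : FiniteMultiplicity 𝔮 (Ideal.span {β}) :=
      FiniteMultiplicity.of_prime_left (Ideal.prime_of_isPrime h0 inferInstance)
        (by rwa [Ne, Ideal.zero_eq_bot, Ideal.span_singleton_eq_bot])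
    obtain ⟨J, hJ, hJ'⟩ := hfin.exists_eq_pow_mul_and_not_dvd
    rw [Ideal.dvd_iff_le] at hJ'
    have hkill : ∀ k ∈ 𝔮 ^ multiplicity 𝔮 (Ideal.span {β}), ∀ j ∈ J,
        algebraMap B A k • algebraMap B A j • y = 0 := by
      intro k hk j hj
      have : k * j ∈ Ideal.span {β} := by
        rw [hJ]
        exact Ideal.mul_mem_mul hk hj
      obtain ⟨c, hc⟩ := Ideal.mem_span_singleton'.1 this
      rw [← mul_smul, ← map_mul, ← hc, map_mul, mul_smul, hy, smul_zero]
    obtain ⟨j, hj, k, hk, h⟩ := hcop J _ hJ'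
    obtain ⟨b, hb, hb'⟩ := SetLike.not_le_iff_exists.1 hJ'
    rw [hdec y j k h]
    refine Submodule.add_mem_sup ⟨b, hb', ?_⟩ ⟨_, fun b hb ↦ hkill b hb j hj⟩
    rw [smul_comm]
    exact hkill k hk b hb

theorem exists_isTorsionProjection [IsDomain A] [IsDedekindDomain B] [Algebra.IsIntegral B A] :
    ∃ e : Aad 𝔭, IsTorsionProjection 𝔮 𝔭 e ∧
      ((∀ P : Ideal A, P.IsPrime → P.comap (algebraMap B A) = 𝔮 → P = 𝔭) → e = 1) := by
  have hkill := LocQuot.exists_algebraMap_smul_eq_zero B 𝔭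
  -- For 𝔮 = 0 every nonzero β lies outside 𝔮, so all of A_(𝔭)/A is prime-to-𝔮 torsion.
  by_cases h0 : 𝔮 = ⊥
  · refine ⟨1, ⟨fun y ↦ ?_, fun y _ ↦ rfl⟩, fun _ ↦ rfl⟩
    obtain ⟨β, hβ, hy⟩ := hkill y
    exact ⟨β, by rwa [h0], hy⟩
  · have hc := isCompl_coprimeTorsion (A := A) 𝔮 h0 (LocQuot 𝔭) hkill
    refine ⟨Aad.ofEnd 𝔭 ((coprimeTorsion A 𝔮 (LocQuot 𝔭)).subtype.comp
      (Submodule.projectionOnto _ _ hc)), ⟨fun y ↦ ?_, fun y hy ↦ ?_⟩, fun hP ↦ ?_⟩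
    · exact (Submodule.projectionOnto _ _ hc y).2
    · exact congrArg Subtype.val (Submodule.projectionOnto_apply_left hc ⟨y, hy⟩)
    · have hbot : primaryTorsion A 𝔮 (LocQuot 𝔭) = ⊥ := by
        rw [eq_bot_iff]
        rintro y ⟨n, hn⟩
        rw [Submodule.mem_bot]
        by_contra hy
        obtain ⟨P, hPmax, hPle⟩ := Ideal.exists_le_maximal
          (LinearMap.ker (LinearMap.toSpanSingleton A (LocQuot 𝔭) y)) (by
            rw [Ne, Ideal.eq_top_iff_one, LinearMap.mem_ker, LinearMap.toSpanSingleton_apply,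
              one_smul]
            exact hy)
        have hle : 𝔮 ≤ P.comap (algebraMap B A) := by
          have hP' : (P.comap (algebraMap B A)).IsPrime := inferInstance
          refine hP'.le_of_pow_le (n := n) fun b hb ↦ hPle ?_
          rw [LinearMap.mem_ker, LinearMap.toSpanSingleton_apply, hn b hb]
        have hq : 𝔮.IsMaximal := Ideal.IsPrime.isMaximal inferInstance h0
        have hP𝔭 := hP P hPmax.isPrime (hq.eq_of_le (Ideal.IsPrime.ne_top inferInstance) hle).symm
        obtain ⟨c, s, rfl⟩ := y.exists_frac
        have hs : (s : A) ∈ P := hPle <| by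
          rw [LinearMap.mem_ker, LinearMap.toSpanSingleton_apply, LocQuot.frac_eq_smul, smul_comm,
            LocQuot.smul_frac, smul_zero]
        rw [hP𝔭] at hs
        exact s.2 hs
      refine LinearMap.ext fun y ↦ ?_
      have : y ∈ coprimeTorsion A 𝔮 (LocQuot 𝔭) := by
        have := hc.sup_eq_top
        rw [hbot, sup_bot_eq] at this
        rw [this]
        trivial
      exact congrArg Subtype.val (Submodule.projectionOnto_apply_left hc ⟨y, this⟩)

end Projection

end DrinfeldTate

namespace DrinfeldTate

variable {B A : Type*} [CommRing B] [CommRing A] [Algebra B A]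
variable {𝔮 : Ideal B} [𝔮.IsPrime] {𝔭 : Ideal A} [𝔭.IsPrime]
variable {h𝔮 : 𝔮 = 𝔭.comap (algebraMap B A)}

/-! ### Extending homomorphisms from B_(𝔮)/B to A_(𝔭)/A -/

section Extension

/-- Extend g linearly to A ⊗_B B_(𝔮)/B, viewed as a submodule of A_(𝔭)/A, and compose with the
projection e onto it. -/
theorem IsTorsionProjection.exists_extension [IsDomain A] {e : Aad 𝔭}
    (he : IsTorsionProjection 𝔮 𝔭 e) {X : Type*} [AddCommGroup X] [Module A X]
    (g : LocQuot 𝔮 →ₛₗ[algebraMap B A] X) :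
    ∃ t : TMod 𝔭 X, ∀ d, t.toHom 𝔭 (locQuotMap 𝔮 𝔭 h𝔮 d) = g d := by
  have hE := locQuotExtend_injective 𝔮 𝔭 h𝔮
  have hmem : ∀ y, e.toEnd 𝔭 y ∈ LinearMap.range (locQuotExtend 𝔮 𝔭 h𝔮) := fun y ↦
    (exists_locQuotExtend_eq_iff 𝔮 𝔭 h𝔮 _).1 (he.mem y)
  refine ⟨TMod.ofHom 𝔭 (((extendLinear g).comp (LinearEquiv.ofInjective _ hE).symm.toLinearMap).comp
    ((e.toEnd 𝔭).codRestrict _ hmem)), fun d ↦ ?_⟩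
  have h1 : locQuotExtend 𝔮 𝔭 h𝔮 (1 ⊗ₜ d) = locQuotMap 𝔮 𝔭 h𝔮 d := one_smul A _
  have h2 : e.toEnd 𝔭 (locQuotMap 𝔮 𝔭 h𝔮 d) = locQuotMap 𝔮 𝔭 h𝔮 d :=
    he.eq_self _ ((exists_locQuotExtend_eq_iff 𝔮 𝔭 h𝔮 _).2 ⟨_, h1⟩)
  have h3 : (LinearEquiv.ofInjective _ hE).symm
      ⟨e.toEnd 𝔭 (locQuotMap 𝔮 𝔭 h𝔮 d), hmem _⟩ = 1 ⊗ₜ d := by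
    rw [LinearEquiv.symm_apply_eq]
    exact Subtype.ext (h2.trans h1.symm)
  refine (congrArg (extendLinear g) h3).trans ?_
  exact one_smul A (g d)

/-- If t vanishes on B_(𝔮)/B, it vanishes on the A-module generated by it, which contains the image
of e. Hence e • t = 0. -/
theorem IsTorsionProjection.toHom_eq_zero {e : Aad 𝔭}
    (he : IsTorsionProjection 𝔮 𝔭 e) {X : Type*} [AddCommGroup X] [Module A X] (t : TMod 𝔭 X)
    (ht : ∀ d, t.toHom 𝔭 (locQuotMap 𝔮 𝔭 h𝔮 d) = 0) : t = (1 - e) • t := by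
  refine TMod.ext 𝔭 fun y ↦ ?_
  have hz : ∀ z, t.toHom 𝔭 (locQuotExtend 𝔮 𝔭 h𝔮 z) = 0 := fun z ↦ by
    induction z using TensorProduct.induction_on with
    | zero => rw [map_zero, map_zero]
    | add z w hz hw => rw [map_add, map_add, hz, hw, add_zero]
    | tmul a d => rw [extendLinear_tmul, map_smul, ht, smul_zero]
  obtain ⟨z, h⟩ := (exists_locQuotExtend_eq_iff 𝔮 𝔭 h𝔮 _).1 (he.mem y)
  rw [sub_smul, one_smul, TMod.sub_toHom, TMod.aad_smul_toHom, ← h, hz, sub_zero]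

theorem tensorToHom_smul (z : A ⊗[B] Aad 𝔮) (b : B) (d : LocQuot 𝔮) :
    tensorToHom 𝔮 𝔭 h𝔮 z (b • d) = algebraMap B A b • tensorToHom 𝔮 𝔭 h𝔮 z d := by
  induction z using TensorProduct.induction_on with
  | zero => rw [map_zero, AddMonoidHom.zero_apply, AddMonoidHom.zero_apply, smul_zero]
  | add z w hz hw => rw [map_add, AddMonoidHom.add_apply, AddMonoidHom.add_apply, hz, hw, smul_add]
  | tmul a g => rw [tensorToHom_tmul, tensorToHom_tmul, map_smul, map_smulₛₗ, smul_comm]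

variable [IsDomain A] [Module.Finite B A] [Module.Projective B A]
variable {π : Aad 𝔭 →ₐ[A] A ⊗[B] Aad 𝔮} (hπ : IsNaturalMap 𝔮 𝔭 h𝔮 π)
include hπ

/-- The homomorphism B_(𝔮)/B → A_(𝔭)/A attached to z extends to an endomorphism of A_(𝔭)/A. -/
theorem IsNaturalMap.surjective {e : Aad 𝔭} (he : IsTorsionProjection 𝔮 𝔭 e) :
    Function.Surjective π := fun z ↦ by
  obtain ⟨t, ht⟩ := he.exists_extension (h𝔮 := h𝔮)
    { toFun := tensorToHom 𝔮 𝔭 h𝔮 z, map_add' := map_add _, map_smul' := tensorToHom_smul z }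
  exact ⟨Aad.ofEnd 𝔭 (t.toHom 𝔭), tensorToHom_ext 𝔮 𝔭 h𝔮 fun d ↦ (hπ _ d).trans (ht d)⟩

theorem IsNaturalMap.map_one_sub {e : Aad 𝔭} (he : IsTorsionProjection 𝔮 𝔭 e) :
    π (1 - e) = 0 := by
  refine tensorToHom_ext 𝔮 𝔭 h𝔮 fun d ↦ ?_
  rw [hπ, map_zero, AddMonoidHom.zero_apply]
  change locQuotMap 𝔮 𝔭 h𝔮 d - e.toEnd 𝔭 (locQuotMap 𝔮 𝔭 h𝔮 d) = 0
  rw [he.eq_self (locQuotMap 𝔮 𝔭 h𝔮 d)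
    ((exists_locQuotExtend_eq_iff 𝔮 𝔭 h𝔮 _).2 ⟨1 ⊗ₜ d, one_smul A _⟩), sub_self]

end Extension

/-! ### Restriction T(X) → T(X') as a base change -/

section Restriction

variable {X X' : Type*} [AddCommGroup X] [Module A X] [AddCommGroup X'] [Module B X']
variable {j : X' →ₛₗ[algebraMap B A] X} (hinj : Function.Injective j)
variable {v : TMod 𝔭 X →+ TMod 𝔮 X'}
variable (hv : ∀ t d, j ((v t).toHom 𝔮 d) = t.toHom 𝔭 (locQuotMap 𝔮 𝔭 h𝔮 d))

include hv in
theorem IsTorsionProjection.eq_one_sub_smul {e : Aad 𝔭} (he : IsTorsionProjection 𝔮 𝔭 e)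
    (t : TMod 𝔭 X) (ht : v t = 0) : t = (1 - e) • t :=
  he.toHom_eq_zero (h𝔮 := h𝔮) t fun d ↦ by rw [← hv, ht, TMod.zero_toHom, map_zero]

include hv in
theorem IsTorsionProjection.restriction_injective (he : IsTorsionProjection 𝔮 𝔭 (1 : Aad 𝔭)) :
    Function.Injective v := by
  rw [injective_iff_map_eq_zero]
  intro t ht
  rw [he.eq_one_sub_smul hv t ht, sub_self, zero_smul]

include hv hinj in
theorem IsTorsionProjection.restriction_surjective [IsDomain A] {e : Aad 𝔭}
    (he : IsTorsionProjection 𝔮 𝔭 e) : Function.Surjective v := fun u ↦ by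
  obtain ⟨t, ht⟩ := he.exists_extension (h𝔮 := h𝔮) (j.comp (u.toHom 𝔮))
  exact ⟨t, TMod.ext 𝔮 fun d ↦ hinj ((hv t d).trans (ht d))⟩

variable [Module A X'] [IsScalarTower B A X'] (hja : ∀ (a : A) (x : X'), j (a • x) = a • j x)
variable {π : Aad 𝔭 →ₐ[A] A ⊗[B] Aad 𝔮} (hπ : IsNaturalMap 𝔮 𝔭 h𝔮 π)

-- Describes the action of A ⊗_B B_ad on a restriction through t itself. For z = π f it gives
-- semilinearity.
include hja hv in
theorem TMod.tensorModule_smul_restriction (z : A ⊗[B] Aad 𝔮) (t : TMod 𝔭 X) (d : LocQuot 𝔮) :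
    letI := TMod.tensorModule (A := A) 𝔮 (X := X')
    j ((z • v t).toHom 𝔮 d) = t.toHom 𝔭 (tensorToHom 𝔮 𝔭 h𝔮 z d) := by
  let _ := TMod.tensorModule (A := A) 𝔮 (X := X')
  induction z using TensorProduct.induction_on with
  | zero =>
    rw [zero_smul, TMod.zero_toHom, map_zero, map_zero, AddMonoidHom.zero_apply, map_zero]
  | add z w hz hw =>
    rw [add_smul, TMod.add_toHom, map_add, map_add, AddMonoidHom.add_apply, map_add, hz, hw]
  | tmul a g =>
    rw [tensorToHom_tmul, map_smul, ← hv, ← hja]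
    rfl

include hja hπ hv hinj in
theorem IsNaturalMap.restriction_smul (f : Aad 𝔭) (t : TMod 𝔭 X) :
    letI := TMod.tensorModule (A := A) 𝔮 (X := X')
    v (f • t) = π f • v t := by
  let _ := TMod.tensorModule (A := A) 𝔮 (X := X')
  refine TMod.ext 𝔮 fun d ↦ hinj ?_
  rw [hv, TMod.tensorModule_smul_restriction hv hja, hπ]
  rfl

include hja hπ hv hinj in
/-- The restriction of homomorphisms from `A_(𝔭) / A` to `B_(𝔮) / B` is a base change. -/
theorem IsNaturalMap.restriction_isBaseChangeAlong [IsDomain A] [Module.Finite B A]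
    [Module.Projective B A] {e : Aad 𝔭} (he : IsTorsionProjection 𝔮 𝔭 e) :
    IsBaseChangeAlong π.toRingHom (TMod.tensorModule (A := A) 𝔮 (X := X')) v :=
  isBaseChangeAlong_of_surjective _ _ _ (hπ.restriction_smul hinj hv hja) (hπ.surjective he)
    (he.restriction_surjective hinj hv) fun t ht ↦
      ⟨1 - e, t, hπ.map_one_sub he, he.eq_one_sub_smul hv t ht⟩

end Restriction

/-! ### The right column M ⊗ A_ad → M ⊗ B_ad -/

section TensorColumn

variable {X Y : Type*} [AddCommGroup X] [Module B X] [Module A X] [IsScalarTower B A X]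
  [AddCommGroup Y] [Module A Y]
variable (π : Aad 𝔭 →ₐ[A] A ⊗[B] Aad 𝔮) (k : Y →ₗ[A] X)

theorem adTensorMap_tmul (f : Aad 𝔭) (y : Y) :
    letI := adTensorModule (A := A) 𝔮 (X := X)
    adTensorMap 𝔮 𝔭 π k (f ⊗ₜ y) = π f • ((1 : Aad 𝔮) ⊗ₜ[B] k y) := rfl

theorem adTensorMap_smul (f : Aad 𝔭) (z : Aad 𝔭 ⊗[A] Y) :
    letI := adTensorModule (A := A) 𝔮 (X := X)
    adTensorMap 𝔮 𝔭 π k (f • z) = π f • adTensorMap 𝔮 𝔭 π k z := by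
  let _ := adTensorModule (A := A) 𝔮 (X := X)
  induction z using TensorProduct.induction_on with
  | zero => rw [smul_zero, map_zero, smul_zero]
  | add z w hz hw => rw [smul_add, map_add, map_add, smul_add, hz, hw]
  | tmul g y =>
    rw [TensorProduct.smul_tmul', adTensorMap_tmul, adTensorMap_tmul, smul_eq_mul, map_mul,
      mul_smul]

theorem tensorLocMap_ofTensor_smul (w : A ⊗[B] Aad 𝔮) (x : X) (d : LocQuot 𝔮) :
    letI := adTensorModule (A := A) 𝔮 (X := X)
    tensorLocMap 𝔮 𝔭 h𝔮 X ((TMod.ofTensor 𝔮 X (w • ((1 : Aad 𝔮) ⊗ₜ[B] x))).toHom 𝔮 d) =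
      x ⊗ₜ[A] tensorToHom 𝔮 𝔭 h𝔮 w d := by
  let _ := adTensorModule (A := A) 𝔮 (X := X)
  induction w using TensorProduct.induction_on with
  | zero =>
    rw [zero_smul, map_zero, map_zero, TMod.zero_toHom, map_zero, AddMonoidHom.zero_apply,
      TensorProduct.tmul_zero]
  | add w v hw hv =>
    rw [add_smul, map_add, map_add, TMod.add_toHom, map_add, hw, hv, AddMonoidHom.add_apply,
      TensorProduct.tmul_add]
  | tmul a g =>
    rw [adTensorModule_smul, mul_one, TMod.ofTensor_tmul, tensorLocMap_tmul, tensorToHom_tmul,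
      TensorProduct.smul_tmul]

-- Under the identification of A_ad ⊗ Y with homomorphisms, the right vertical map is again
-- restriction to B_(𝔮)/B.
variable {π} in
theorem IsNaturalMap.tensorLocMap_adTensorMap (hπ : IsNaturalMap 𝔮 𝔭 h𝔮 π) (z : Aad 𝔭 ⊗[A] Y)
    (d : LocQuot 𝔮) :
    tensorLocMap 𝔮 𝔭 h𝔮 X ((TMod.ofTensor 𝔮 X (adTensorMap 𝔮 𝔭 π k z)).toHom 𝔮 d) =
      k.rTensor (LocQuot 𝔭) ((TMod.ofTensor 𝔭 Y z).toHom 𝔭 (locQuotMap 𝔮 𝔭 h𝔮 d)) := by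
  induction z using TensorProduct.induction_on with
  | zero => simp only [map_zero, TMod.zero_toHom]
  | add z w hz hw => simp only [map_add, TMod.add_toHom, hz, hw]
  | tmul f y =>
    rw [adTensorMap_tmul, tensorLocMap_ofTensor_smul, hπ, TMod.ofTensor_tmul,
      LinearMap.rTensor_tmul]

end TensorColumn

/-! ### Commutativity of the diagram -/

section Squares

variable {N N' : Type*} [AddCommGroup N] [Module A N] [AddCommGroup N'] [Module B N']
variable (e : N' →ₛₗ[algebraMap B A] N) (he : Function.Bijective e)
variable (M : Submodule A N) (M' : Submodule B N') (hM : ∀ x, x ∈ M' ↔ e x ∈ M)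

theorem tateResDivQuot_tateIncl
    (t : TMod 𝔭 ↥(Div 𝔭 (⊥ : Submodule A N))) :
    tateResDivQuot 𝔮 𝔭 h𝔮 e he M M' hM (tateIncl 𝔭 M t) =
      tateIncl 𝔮 M' (tateResTorsion 𝔮 𝔭 h𝔮 e he t) := by
  refine TMod.ext 𝔮 fun d ↦ divQuotMap_injective 𝔮 𝔭 h𝔮 e M M' hM ?_
  rw [tateResDivQuot_spec]
  exact congrArg Submodule.Quotient.mk (Subtype.ext (tateResTorsion_spec 𝔮 𝔭 h𝔮 e he t d).symm)

variable [Module A M'] [IsScalarTower B A M'] (k : M →ₗ[A] M') (hk : ∀ m, e (k m).1 = m.1)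

include he hk in
theorem tensorLocMap_divQuotToTensor (x : DivQuot 𝔮 M') :
    tensorLocMap 𝔮 𝔭 h𝔮 M' (divQuotToTensor 𝔮 M' x) =
      k.rTensor (LocQuot 𝔭) (divQuotToTensor 𝔭 M (divQuotMap 𝔮 𝔭 h𝔮 e M M' hM x)) := by
  obtain ⟨⟨x, b, hb, hx⟩, rfl⟩ := Submodule.Quotient.mk_surjective _ x
  have hx' : algebraMap B A b • e x ∈ M := by rw [← map_smulₛₗ]; exact (hM _).1 hx
  have h1 := divQuotToTensor_mk M' ⟨x, b, hb, hx⟩ ⟨b, hb⟩ hx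
  have h2 := divQuotToTensor_mk M (divMap 𝔮 𝔭 h𝔮 e M M' hM ⟨x, b, hb, hx⟩)
    ⟨_, not_mem_of_comap 𝔮 𝔭 h𝔮 hb⟩ hx'
  refine (congrArg _ h1).trans (Eq.trans ?_ (congrArg _ h2).symm)
  rw [tensorLocMap_tmul, LinearMap.rTensor_tmul, locQuotMap_frac, map_one]
  congr 1
  refine Subtype.ext (he.1 ?_)
  rw [hk]
  exact map_smulₛₗ e b x

-- Both sides may be compared after the injections into homomorphisms with values in M' ⊗_A A_(𝔭)/A.
-- There both are the restriction of the map sending d to the image of t(d).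
include hk in
theorem adTensorMap_tateProj [IsDomain A] [Module.Flat A M']
    (hb : Function.Bijective (TMod.ofTensor 𝔭 M)) (hb' : Function.Bijective (TMod.ofTensor 𝔮 M'))
    {π : Aad 𝔭 →ₐ[A] A ⊗[B] Aad 𝔮} (hπ : IsNaturalMap 𝔮 𝔭 h𝔮 π) (t : TMod 𝔭 (DivQuot 𝔭 M)) :
    adTensorMap 𝔮 𝔭 π k (tateProj 𝔭 M t) =
      tateProj 𝔮 M' (tateResDivQuot 𝔮 𝔭 h𝔮 e he M M' hM t) := by
  refine hb'.1 (TMod.ext 𝔮 fun d ↦ tensorLocMap_injective 𝔮 𝔭 h𝔮 M' ?_)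
  rw [hπ.tensorLocMap_adTensorMap, tateProj_eq M hb, tateProj_eq M' hb', TMod.map_toHom,
    TMod.map_toHom, tensorLocMap_divQuotToTensor e he M M' hM k hk, tateResDivQuot_spec]

end Squares

/-! ### The left and middle columns for a Drinfeld module -/

section Column

variable {p : ℕ} [Fact p.Prime] {K : Type*} [Field K] [CharP K p]
variable {A : Type*} [CommRing A] (φ : A →+* TwistedPoly p K) (B : Subring A)
variable (L : Type*) [Field L] [Algebra K L]

theorem mem_bot_iff_pointsId (x : Points (restrict φ B) L) :
    x ∈ (⊥ : Submodule B (Points (restrict φ B) L)) ↔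
      pointsId φ B L x ∈ (⊥ : Submodule A (Points φ L)) := Iff.rfl

/-- The inclusion of the torsion of `ψ` into that of `φ`. -/
abbrev torsionIncl :=
  divMap (characteristic (restrict φ B)) (characteristic φ) (characteristic_restrict φ B)
    (pointsId φ B L) ⊥ ⊥ (mem_bot_iff_pointsId φ B L)

theorem torsionIncl_injective : Function.Injective (torsionIncl φ B L) :=
  divMap_injective _ _ _ _ _ _ _ (pointsId_bijective φ B L).1

theorem torsionIncl_vertTad (t : Tad φ L) (d : LocQuot (characteristic (restrict φ B))) :
    torsionIncl φ B L ((vertTad φ B L t).toHom _ d) =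
      t.toHom _ (locQuotMap _ _ (characteristic_restrict φ B) d) :=
  Subtype.ext (tateResTorsion_spec _ _ (characteristic_restrict φ B) (pointsId φ B L)
    (pointsId_bijective φ B L) t d)

variable {φ L} (M : Submodule A (Points φ L))

/-- The inclusion of the division hulls modulo `M`. -/
abbrev divQuotIncl :=
  divQuotMap (characteristic (restrict φ B)) (characteristic φ) (characteristic_restrict φ B)
    (pointsId φ B L) M (restrictSub B M) (fun _ ↦ Iff.rfl)

theorem divQuotIncl_injective : Function.Injective (divQuotIncl B M) :=
  divQuotMap_injective _ _ _ _ _ _ _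

theorem divQuotIncl_vertTadExt (t : TadExt M) (d : LocQuot (characteristic (restrict φ B))) :
    divQuotIncl B M ((vertTadExt B M t).toHom _ d) =
      t.toHom _ (locQuotMap _ _ (characteristic_restrict φ B) d) :=
  tateResDivQuot_spec _ _ _ _ _ _ _ _ t d

theorem restrictSubId_surjective : Function.Surjective (restrictSubId B M) :=
  fun x ↦ ⟨⟨x.1, x.2⟩, rfl⟩

theorem restrictSub_isTorsionFree [Module.IsTorsionFree A M] :
    Module.IsTorsionFree A (restrictSub B M) :=
  Function.Injective.moduleIsTorsionFree
    (LinearEquiv.ofBijective (restrictSubId B M) ⟨fun _ _ h ↦ Subtype.ext (congrArg Subtype.val h),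
      restrictSubId_surjective B M⟩).symm (LinearEquiv.injective _) (fun _ _ ↦ map_smul _ _ _)

variable [IsDomain A] [Module.Finite B A] [Module.Projective B A]
variable {π : Rad φ →ₐ[A] ABad φ B}
  (hπ : IsNaturalMap _ _ (characteristic_restrict φ B) π)
variable {e : Rad φ}
  (he : IsTorsionProjection (characteristic (restrict φ B)) (characteristic φ) e)

include hπ he

variable (L) in
theorem vertTad_isBaseChangeAlong :
    IsBaseChangeAlong π.toRingHom (tadModule φ B L) (vertTad φ B L) := by
  let _ := stableModule (A := A) (Div (characteristic (restrict φ B))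
    (⊥ : Submodule B (Points (restrict φ B) L))) (Div_stable _ (bot_stable (A := A)))
  have := stableModule_tower (A := A) (Div (characteristic (restrict φ B))
    (⊥ : Submodule B (Points (restrict φ B) L))) (Div_stable _ (bot_stable (A := A)))
  exact hπ.restriction_isBaseChangeAlong (torsionIncl_injective φ B L) (torsionIncl_vertTad φ B L)
    (fun a x ↦ rfl) he

theorem vertTadExt_isBaseChangeAlong :
    IsBaseChangeAlong π.toRingHom (tadExtModule B M) (vertTadExt B M) := by
  let _ := divQuotModule (characteristic (restrict φ B)) _ (restrictSub_stable B M)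
  have := divQuotModule_tower (characteristic (restrict φ B)) _ (restrictSub_stable B M)
  refine hπ.restriction_isBaseChangeAlong (divQuotIncl_injective B M)
    (divQuotIncl_vertTadExt B M) (fun a x ↦ ?_) he
  obtain ⟨y, rfl⟩ := Submodule.Quotient.mk_surjective _ x
  rfl

end Column

/-! ### The comparison theorem for Dedekind domains -/

section Comparison

/-- Over a Dedekind domain torsion free modules are flat, and finitely presented flat modules are
projective. -/
theorem projective_of_isTorsionFree (R X : Type*) [CommRing R] [IsDedekindDomain R]
    [AddCommGroup X] [Module R X] [Module.Finite R X] [Module.IsTorsionFree R X] :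
    Module.Projective R X :=
  have := Module.finitePresentation_of_finite R X
  Module.Flat.projective_of_finitePresentation

variable {p : ℕ} [Fact p.Prime] {K : Type*} [Field K] [CharP K p]
variable {A : Type*} [CommRing A] [IsDedekindDomain A] [Countable A]
variable (φ : A →+* TwistedPoly p K)
variable {L : Type*} [Field L] [Algebra K L] (M : Submodule A (Points φ L))
variable (B : Subring A) [IsDedekindDomain B] [Module.Finite B A]

theorem comparison (hM : M.FG) [Module.IsTorsionFree A M]
    (hL : ∀ a, a ∉ characteristic φ → ∀ y : Points φ L, ∃ x : Points φ L, a • x = y) :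
    TateSequenceExact (characteristic φ) M ∧
    TateSequenceExact (characteristic (restrict φ B)) (restrictSub B M) ∧
    ∃ π : Rad φ →ₐ[A] ABad φ B,
      IsNaturalMap _ _ (characteristic_restrict φ B) π ∧
      (∀ π' : Rad φ →ₐ[A] ABad φ B,
        IsNaturalMap _ _ (characteristic_restrict φ B) π' → π' = π) ∧
      Function.Surjective π ∧
      (∀ t : Tad φ L,
        vertTadExt B M (tadIncl M t) = tadIncl (restrictSub B M) (vertTad φ B L t)) ∧
      (∀ t : TadExt M,
        vertTensor B M π (tadProj M t) = tadProj (restrictSub B M) (vertTadExt B M t)) ∧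
      IsBaseChangeAlong π.toRingHom (tadModule φ B L) (vertTad φ B L) ∧
      IsBaseChangeAlong π.toRingHom (tadExtModule B M) (vertTadExt B M) ∧
      IsBaseChangeAlong π.toRingHom (radTensorModule B M) (vertTensor B M π) ∧
      Function.Surjective (vertTad φ B L) ∧
      Function.Surjective (vertTadExt B M) ∧
      Function.Surjective (vertTensor B M π) ∧
      ((∀ P : Ideal A, P.IsPrime →
          P.comap (algebraMap B A) = characteristic (restrict φ B) → P = characteristic φ) →
        Function.Bijective (vertTad φ B L) ∧
        Function.Bijective (vertTadExt B M) ∧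
        Function.Bijective (vertTensor B M π)) := by
  have : Module.IsTorsionFree B A := inferInstance
  have : Module.IsTorsionFree A (restrictSub B M) := restrictSub_isTorsionFree B M
  have : Module.IsTorsionFree B (restrictSub B M) := Module.IsTorsionFree.trans_faithfulSMul B A _
  have : Module.Finite A M := Module.Finite.iff_fg.2 hM
  have : Module.Finite A (restrictSub B M) :=
    Module.Finite.of_surjective _ (restrictSubId_surjective B M)
  have : Module.Finite B (restrictSub B M) := Module.Finite.trans A _
  have := projective_of_isTorsionFree A M
  have := projective_of_isTorsionFree B A
  have := projective_of_isTorsionFree B (restrictSub B M)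
  have hA : TateSequenceExact (characteristic φ) M := tateSequenceExact M hL
  have hB : TateSequenceExact (characteristic (restrict φ B)) (restrictSub B M) :=
    tateSequenceExact _ fun b hb y ↦ hL b (not_mem_of_comap _ _ (characteristic_restrict φ B) hb) y
  obtain ⟨π, hπ, huniq⟩ := exists_unique_isNaturalMap (characteristic (restrict φ B))
    (characteristic φ) (characteristic_restrict φ B)
  obtain ⟨e, he, he1⟩ := exists_isTorsionProjection (characteristic (restrict φ B))
    (characteristic φ)
  have hs1 : Function.Surjective (vertTad φ B L) :=
    he.restriction_surjective (torsionIncl_injective φ B L) (torsionIncl_vertTad φ B L)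
  have hs2 : Function.Surjective (vertTadExt B M) :=
    he.restriction_surjective (divQuotIncl_injective B M) (divQuotIncl_vertTadExt B M)
  have hsq1 : ∀ t : Tad φ L,
      vertTadExt B M (tadIncl M t) = tadIncl (restrictSub B M) (vertTad φ B L t) :=
    fun t ↦ tateResDivQuot_tateIncl _ _ _ _ _ t
  have hsq2 : ∀ t : TadExt M,
      vertTensor B M π (tadProj M t) = tadProj (restrictSub B M) (vertTadExt B M t) :=
    fun t ↦ adTensorMap_tateProj _ _ _ _ _ _ (fun _ ↦ rfl) hA.ofTensor_bijective
      hB.ofTensor_bijective hπ t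
  -- The lower projection and the middle vertical map are surjective, and the right square commutes.
  have hs3 : Function.Surjective (vertTensor B M π) := fun z ↦ by
    obtain ⟨u, rfl⟩ := hB.surjective z
    obtain ⟨t, rfl⟩ := hs2 u
    exact ⟨_, hsq2 t⟩
  -- Diagram chase: lift z to t. The restriction of t comes from T_ad(ψ), hence from some u in
  -- T_ad(φ). Subtracting u from t leaves an element of the kernel of the middle map, which is fixed
  -- by 1 - e', and its projection is still z.
  have hker : ∀ e' : Rad φ,
      IsTorsionProjection (characteristic (restrict φ B)) (characteristic φ) e' →
      ∀ z, vertTensor B M π z = 0 → ∃ w, z = (1 - e') • w := by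
    intro e' he' z hz
    obtain ⟨t, rfl⟩ := hA.surjective z
    rw [hsq2] at hz
    obtain ⟨u, hu⟩ := (hB.exact _).1 hz
    obtain ⟨u, rfl⟩ := hs1 u
    rw [← hsq1, eq_comm, ← sub_eq_zero, ← map_sub] at hu
    have ht := he'.eq_one_sub_smul (divQuotIncl_vertTadExt B M) _ hu
    refine ⟨tadProj M (t - tadIncl M u), ?_⟩
    have h0 : tadProj M (tadIncl M u) = 0 := (hA.exact _).2 ⟨u, rfl⟩
    rw [← map_smul, ← ht, map_sub, h0, sub_zero]
  refine ⟨hA, hB, π, hπ, huniq, hπ.surjective he, hsq1, hsq2, vertTad_isBaseChangeAlong B L hπ he,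
    vertTadExt_isBaseChangeAlong B M hπ he,
    isBaseChangeAlong_of_surjective _ _ _ (adTensorMap_smul π _) (hπ.surjective he) hs3
      fun z hz ↦ ?_, hs1, hs2, hs3, fun hP ↦ ?_⟩
  · obtain ⟨w, hw⟩ := hker e he z hz
    exact ⟨1 - e, w, hπ.map_one_sub he, hw⟩
  · obtain rfl := he1 hP
    refine ⟨⟨he.restriction_injective (torsionIncl_vertTad φ B L), hs1⟩,
      ⟨he.restriction_injective (divQuotIncl_vertTadExt B M), hs2⟩, ?_, hs3⟩
    rw [injective_iff_map_eq_zero]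
    intro z hz
    obtain ⟨w, rfl⟩ := hker 1 he z hz
    rw [sub_self, zero_smul]

end Comparison

end DrinfeldTate

namespace DrinfeldTate

/-! ### Divisibility of a separably closed field -/

section Divisible

variable {p : ℕ} [Fact p.Prime] {K : Type*} [Field K] [CharP K p]

/-- A separably closed field is divisible by all elements outside the characteristic. -/
theorem exists_points_smul_eq {R : Type*} [CommRing R] (φ : R →+* TwistedPoly p K) {L : Type*}
    [Field L] [Algebra K L] [IsSepClosed L] (a : R) (ha : a ∉ characteristic φ)
    (y : Points φ L) : ∃ x : Points φ L, a • x = y := by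
  have : CharP L p := charP_of_injective_algebraMap (algebraMap K L).injective p
  let f : SkewPolynomial K := φ a
  let c : L := algebraMap K L (SkewPolynomial.coeff f 0)
  have hc : c ≠ 0 := by
    rw [Ne, map_eq_zero]
    exact ha
  -- The polynomial φ_a(X) - y. All exponents p^n with n > 0 vanish in L, so its derivative is the
  -- constant dφ_a, which is nonzero; hence P is nonconstant and separable.
  let P : Polynomial L := ∑ n ∈ f.support,
    Polynomial.C (algebraMap K L (SkewPolynomial.coeff f n)) * Polynomial.X ^ p ^ n -
      Polynomial.C (show L from y)
  have hderiv : P.derivative = Polynomial.C c := by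
    rw [Polynomial.derivative_sub, Polynomial.derivative_C, sub_zero, Polynomial.derivative_sum,
      Finset.sum_eq_single_of_mem 0]
    · rw [pow_zero, pow_one, Polynomial.derivative_C_mul, Polynomial.derivative_X, mul_one]
    · exact SkewPolynomial.mem_support_iff.2 ha
    · intro n _ hn
      rw [Polynomial.derivative_C_mul, Polynomial.derivative_X_pow, Nat.cast_pow,
        CharP.cast_eq_zero, zero_pow hn, Polynomial.C_0, zero_mul, mul_zero]
  have hdeg : P.degree ≠ 0 := by
    intro h
    rw [Polynomial.eq_C_of_degree_eq_zero h, Polynomial.derivative_C, eq_comm,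
      Polynomial.C_eq_zero] at hderiv
    exact hc hderiv
  have hsep : P.Separable := by
    rw [Polynomial.separable_def, hderiv]
    exact ⟨0, Polynomial.C c⁻¹, by rw [zero_mul, zero_add, ← Polynomial.C_mul, inv_mul_cancel₀ hc,
      Polynomial.C_1]⟩
  obtain ⟨x, hx⟩ := IsSepClosed.exists_root P hdeg hsep
  refine ⟨x, ?_⟩
  refine (evalHom_apply p K L (φ a) x).trans ?_
  refine (SkewPolynomial.sum_def (p := f) _).trans ?_
  rw [Polynomial.IsRoot.def, Polynomial.eval_sub, Polynomial.eval_C, sub_eq_zero,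
    Polynomial.eval_finsetSum] at hx
  refine Eq.trans ?_ hx
  refine Finset.sum_congr rfl fun n _ ↦ ?_
  rw [Polynomial.eval_mul, Polynomial.eval_C, Polynomial.eval_pow, Polynomial.eval_X]

end Divisible

/-! ### Finiteness of integral closures in characteristic p -/

section Frobenius

theorem finite_of_comp_injective {R C D : Type*} [CommRing R] [IsNoetherianRing R] [CommRing C]
    [CommRing D] (f : R →+* C) (g : C →+* D) (hg : Function.Injective g)
    (h : (g.comp f).Finite) : f.Finite := by
  let _ := f.toAlgebra
  let _ := (g.comp f).toAlgebra
  have : Module.Finite R D := h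
  exact Module.Finite.of_injective
    ({ toFun := g, map_add' := map_add g, map_smul' := fun r c ↦ by
        rw [Algebra.smul_def, Algebra.smul_def, map_mul]; rfl } : C →ₗ[R] D) hg

theorem iterateFrobenius_finite {R : Type*} [CommRing R] (p : ℕ) [Fact p.Prime] [CharP R p]
    (h : (frobenius R p).Finite) (n : ℕ) : (iterateFrobenius R p n).Finite := by
  induction n with
  | zero =>
    have : iterateFrobenius R p 0 = RingHom.id R := RingHom.ext fun x ↦ by
      rw [iterateFrobenius_def, pow_zero, pow_one, RingHom.id_apply]
    rw [this]
    exact RingHom.Finite.id R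
  | succ n ih =>
    have : iterateFrobenius R p (n + 1) = (iterateFrobenius R p n).comp (frobenius R p) :=
      RingHom.ext fun x ↦ by
        rw [iterateFrobenius_add_apply, iterateFrobenius_one_apply]; rfl
    rw [this]
    exact ih.comp h

/-- Frobenius is integral, as y is a root of X^p - y^p. It is of finite type because it fixes the
constants 𝔽_p. -/
theorem polynomial_frobenius_finite (p : ℕ) [Fact p.Prime] :
    (frobenius (Polynomial (ZMod p)) p).Finite := by
  refine RingHom.IsIntegral.to_finite (fun y ↦ ?_) ?_
  · refine ⟨Polynomial.X ^ p - Polynomial.C y,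
      Polynomial.monic_X_pow_sub_C y (Fact.out : p.Prime).ne_zero, ?_⟩
    rw [Polynomial.eval₂_sub, Polynomial.eval₂_X_pow, Polynomial.eval₂_C, frobenius_def, sub_self]
  · refine RingHom.FiniteType.of_comp_finiteType (f := Polynomial.C) ?_
    have : (frobenius (Polynomial (ZMod p)) p).comp Polynomial.C = Polynomial.C :=
      RingHom.ext fun a ↦ by
        rw [RingHom.comp_apply, frobenius_def, ← map_pow, ZMod.pow_card]
    rw [this]
    exact RingHom.finiteType_algebraMap.2 (inferInstanceAs
      (Algebra.FiniteType (ZMod p) (Polynomial (ZMod p))))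

/-- Let `R` be a noetherian integrally closed domain of characteristic `p` that is finite over its
subring of `p`-th powers. Then the integral closure of `R` in any finite extension of its field of
fractions is finite over `R`. -/
theorem finite_integralClosure_of_frobenius_finite (p : ℕ) [Fact p.Prime] (R E F C : Type*)
    [CommRing R] [IsDomain R] [IsNoetherianRing R] [IsIntegrallyClosed R] [CharP R p]
    (hR : (frobenius R p).Finite) [Field E] [Algebra R E] [IsFractionRing R E] [Field F]
    [Algebra R F] [Algebra E F] [IsScalarTower R E F] [FiniteDimensional E F] [CommRing C]
    [Algebra R C] [Algebra C F] [IsScalarTower R C F] [IsIntegralClosure C R F] :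
    Module.Finite R C := by
  have : CharP E p := charP_of_injective_algebraMap (IsFractionRing.injective R E) p
  have : CharP F p := charP_of_injective_algebraMap (algebraMap E F).injective p
  let S := separableClosure E F
  have : CharP S p := charP_of_injective_algebraMap (algebraMap E S).injective p
  have : IsScalarTower R S F :=
    IsScalarTower.of_algebraMap_eq fun _ ↦ rfl
  -- The p^n-th power map embeds C into the integral closure of R in the separable part S, which is
  -- finite over R. This embedding is semilinear over the n-th Frobenius iterate of R, itself
  -- finite, so C is a submodule of a finite module over the noetherian ring R.
  let n := IsPurelyInseparable.exponent S F
  have hfin : Module.Finite R (integralClosure R S) :=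
    IsIntegralClosure.finite R E S (integralClosure R S)
  have hmem : ∀ c : C, iterateFrobenius F p n (algebraMap C F c) ∈ S := fun c ↦ by
    obtain ⟨s, hs⟩ : ∃ s : S, algebraMap S F s = algebraMap C F c ^ p ^ n :=
      IsPurelyInseparable.exponent_def' S p (algebraMap C F c)
    rw [iterateFrobenius_def, ← hs]
    exact s.2
  let g1 : C →+* S := ((iterateFrobenius F p n).comp (algebraMap C F)).codRestrict S.toSubring hmem
  have hint : ∀ c : C, g1 c ∈ integralClosure R S := fun c ↦ by
    have h1 : IsIntegral R (algebraMap C F c) := (IsIntegralClosure.isIntegral R F c).algebraMap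
    have h2 : IsIntegral R (algebraMap S F (g1 c)) := h1.pow (p ^ n)
    exact (isIntegral_algebraMap_iff (algebraMap S F).injective).1 h2
  let g : C →+* integralClosure R S := g1.codRestrict (integralClosure R S).toSubring hint
  have hg : Function.Injective g := fun a b hab ↦ by
    refine IsIntegralClosure.algebraMap_injective C R F ?_
    refine (iterateFrobenius F p n).injective ?_
    exact congrArg (fun z : integralClosure R S ↦ ((z : S) : F)) hab
  have hcomp : g.comp (algebraMap R C) =
      (algebraMap R (integralClosure R S)).comp (iterateFrobenius R p n) := by
    refine RingHom.ext fun r ↦ Subtype.ext (Subtype.ext ?_)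
    change iterateFrobenius F p n (algebraMap C F (algebraMap R C r)) =
      algebraMap R F (iterateFrobenius R p n r)
    rw [← IsScalarTower.algebraMap_apply, iterateFrobenius_def, iterateFrobenius_def, map_pow]
  refine RingHom.finite_algebraMap.1 (finite_of_comp_injective _ g hg ?_)
  rw [hcomp]
  exact (RingHom.finite_algebraMap.2 hfin).comp (iterateFrobenius_finite p hR n)

end Frobenius

/-! ### Function fields of one variable and the ring of regular functions -/

section FunctionField

open Polynomial

variable {p : ℕ} [Fact p.Prime] {F : Type*} [Field F] [Algebra (ZMod p) F]

theorem finite_integralClosure_polynomial [Algebra.EssFiniteType (ZMod p) F]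
    (hF1 : Algebra.trdeg (ZMod p) F = 1) [Algebra (ZMod p)[X] F]
    [IsScalarTower (ZMod p) (ZMod p)[X] F] [FaithfulSMul (ZMod p)[X] F]
    (C : Type*) [CommRing C] [Algebra (ZMod p)[X] C] [Algebra C F]
    [IsScalarTower (ZMod p)[X] C F] [IsIntegralClosure C (ZMod p)[X] F] :
    Module.Finite (ZMod p)[X] C := by
  -- Transcendence degrees add up in 𝔽_p ⊂ 𝔽_p[X] ⊂ F, and the first step already has degree 1.
  have halg : Algebra.IsAlgebraic (ZMod p)[X] F := by
    have h := lift_trdeg_add_eq (ZMod p) (ZMod p)[X] F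
    rw [Polynomial.trdeg_of_isDomain, hF1, Cardinal.lift_one, Cardinal.lift_one] at h
    have h0 := (Cardinal.add_right_inj_of_lt_aleph0 Cardinal.one_lt_aleph0).1
      (((add_comm _ _).trans h).trans (zero_add 1).symm)
    rw [Cardinal.lift_eq_zero] at h0
    exact trdeg_eq_zero_iff.1 h0
  let _ := FractionRing.liftAlgebra (ZMod p)[X] F
  have : IsScalarTower (ZMod p) (FractionRing (ZMod p)[X]) F :=
    IsScalarTower.to₁₃₄ (ZMod p) (ZMod p)[X] _ _
  have : Algebra.EssFiniteType (FractionRing (ZMod p)[X]) F := .of_comp (ZMod p) _ _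
  have : Algebra.IsAlgebraic (FractionRing (ZMod p)[X]) F :=
    (IsFractionRing.comap_isAlgebraic_iff (A := (ZMod p)[X])).1 halg
  have : FiniteDimensional (FractionRing (ZMod p)[X]) F :=
    Algebra.finite_of_essFiniteType_of_isAlgebraic
  exact finite_integralClosure_of_frobenius_finite p (ZMod p)[X] (FractionRing (ZMod p)[X]) F C
    (polynomial_frobenius_finite p)

variable (p) in
/-- The algebra structure on `F` over the polynomial ring given by an element of `F`. -/
abbrev polynomialAlgebra (x : F) : Algebra (ZMod p)[X] F := (aeval x).toRingHom.toAlgebra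

theorem polynomialAlgebra_tower (x : F) :
    letI := polynomialAlgebra p x
    IsScalarTower (ZMod p) (ZMod p)[X] F :=
  letI := polynomialAlgebra p x
  IsScalarTower.of_algebraMap_eq fun a ↦ (aeval_C x a).symm

theorem polynomialAlgebra_faithful {x : F} (hx : Transcendental (ZMod p) x) :
    letI := polynomialAlgebra p x
    FaithfulSMul (ZMod p)[X] F :=
  letI := polynomialAlgebra p x
  (faithfulSMul_iff_algebraMap_injective _ _).2 (transcendental_iff_injective.1 hx)

/-- The elements of F algebraic over 𝔽_p form a finite field: they lie in the integral closure C of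
some 𝔽_p[t] and embed into the finite ring C/(t). -/
theorem exists_transcendental_of_infinite [Algebra.EssFiniteType (ZMod p) F]
    (hF1 : Algebra.trdeg (ZMod p) F = 1) (B : Subring F) (hB : Infinite B) :
    ∃ x ∈ B, Transcendental (ZMod p) x := by
  by_contra! hcon
  have halg : ∀ b ∈ B, IsIntegral (ZMod p) b := fun b hb ↦
    (not_not.1 (hcon b hb) : IsAlgebraic (ZMod p) b).isIntegral
  obtain ⟨t, ht⟩ : ∃ t : F, Transcendental (ZMod p) t := by
    by_contra! h
    have : Algebra.IsAlgebraic (ZMod p) F := ⟨fun x ↦ not_not.1 (h x)⟩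
    rw [trdeg_eq_zero_iff.2 this] at hF1
    exact zero_ne_one hF1
  let _ := polynomialAlgebra p t
  have := polynomialAlgebra_tower (p := p) t
  have := polynomialAlgebra_faithful ht
  let C := integralClosure (ZMod p)[X] F
  have : Module.Finite (ZMod p)[X] C := finite_integralClosure_polynomial hF1 C
  let T : C := algebraMap (ZMod p)[X] C X
  have hT : ¬ IsUnit T := fun h ↦ Polynomial.not_isUnit_X
    ((RingHom.IsIntegral.isLocalHom (f := algebraMap (ZMod p)[X] C) (Algebra.IsIntegral.isIntegral)
      (FaithfulSMul.algebraMap_injective _ _)).map_nonunit _ h)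
  -- C is finite over 𝔽_p[t], so C/(t) is spanned over 𝔽_p by finitely many elements.
  have hfin : Finite (C ⧸ Ideal.span {T}) := by
    obtain ⟨n, s, hs⟩ := Module.Finite.exists_fin (R := (ZMod p)[X]) (M := C)
    refine Finite.of_surjective (fun v : Fin n → ZMod p ↦
      Ideal.Quotient.mk (Ideal.span {T}) (∑ i, algebraMap (ZMod p)[X] C (Polynomial.C (v i)) * s i)) ?_
    intro z
    obtain ⟨c, rfl⟩ := Ideal.Quotient.mk_surjective z
    obtain ⟨f, rfl⟩ := (Submodule.mem_span_range_iff_exists_fun _).1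
      (hs ▸ Submodule.mem_top : c ∈ Submodule.span (ZMod p)[X] (Set.range s))
    refine ⟨fun i ↦ (f i).coeff 0, ?_⟩
    refine (map_sum _ _ _).trans ((Finset.sum_congr rfl fun i _ ↦ ?_).trans (map_sum _ _ _).symm)
    rw [Algebra.smul_def, Ideal.Quotient.eq, ← sub_mul, ← map_sub, Ideal.mem_span_singleton]
    refine Dvd.dvd.mul_right (_root_.map_dvd _ ?_) _
    rw [Polynomial.X_dvd_iff, Polynomial.coeff_sub, Polynomial.coeff_C_zero, sub_self]
  have hint : ∀ b : F, IsIntegral (ZMod p) b → b ∈ C := fun b hb ↦ hb.tower_top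
  -- A nonzero difference of algebraic elements has an algebraic inverse and so is a unit of C. If t
  -- divided it, t would be a unit.
  refine hB.not_finite (Finite.of_injective (fun b : B ↦
    Ideal.Quotient.mk (Ideal.span {T}) ⟨b.1, hint _ (halg b.1 b.2)⟩) fun a b hab ↦ ?_)
  rw [Ideal.Quotient.eq, Ideal.mem_span_singleton] at hab
  obtain ⟨c, hc⟩ := hab
  by_contra hne
  have hd : a.1 - b.1 ≠ 0 := sub_ne_zero.2 fun h ↦ hne (Subtype.ext h)
  have hinv : (a.1 - b.1)⁻¹ ∈ C := hint _
    ((halg _ (B.sub_mem a.2 b.2)).isAlgebraic.inv.isIntegral)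
  refine hT (IsUnit.of_mul_eq_one (c * ⟨_, hinv⟩) ?_)
  rw [← mul_assoc, ← hc]
  exact Subtype.ext (mul_inv_cancel₀ hd)

/-- An integrally closed subring of a field is the intersection of the valuation rings containing
it. -/
theorem exists_valuationSubring {R : Subring F} (hR : ∀ y : F, IsIntegral R y → y ∈ R) {x : F}
    (hx : x ∉ R) : ∃ V : ValuationSubring F, R ≤ V.toSubring ∧ x ∉ V :=
  have : IsIntegrallyClosedIn R F := Subring.isIntegrallyClosedIn_iff.2 fun {y} hy ↦ hR y hy
  Subring.exists_le_valuationSubring_of_isIntegrallyClosedIn hx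

theorem exists_valuationSubring_of_not_mem_integralClosure {R : Type*} [CommRing R] [Algebra R F]
    {x : F} (hx : ¬ IsIntegral R x) :
    ∃ V : ValuationSubring F, (∀ r, algebraMap R F r ∈ V) ∧ x ∉ V := by
  obtain ⟨V, hV, hxV⟩ := exists_valuationSubring (R := (integralClosure R F).toSubring)
    (fun y hy ↦ by
      have : IsIntegral (integralClosure R F) y := hy
      exact isIntegral_trans y this) hx
  exact ⟨V, fun r ↦ hV (algebraMap_mem (integralClosure R F) r), hxV⟩

theorem mem_valuationSubring_of_isIntegral {R : Type*} [CommRing R] [Algebra R F]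
    (V : ValuationSubring F) (hV : ∀ r, algebraMap R F r ∈ V) {y : F} (hy : IsIntegral R y) :
    y ∈ V := by
  let _ : Algebra R V := ((algebraMap R F).codRestrict V.toSubring hV).toAlgebra
  have : IsScalarTower R V F := IsScalarTower.of_algebraMap_eq fun _ ↦ rfl
  obtain ⟨v, rfl⟩ := IsIntegrallyClosed.isIntegral_iff.1 (hy.tower_top (A := V))
  exact v.2

theorem mem_regularOutside {v : ValuationSubring F} {y : F} :
    y ∈ regularOutside v ↔ ∀ P : ValuationSubring F, P ≠ ⊤ → P ≠ v → y ∈ P := by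
  simp only [regularOutside, Subring.mem_iInf, Set.mem_ofPred_eq, and_imp]
  rfl

/-- If `x` is a non-constant function that is regular outside a place, then the ring of all
functions regular outside this place is the integral closure of `𝔽_p[x]`. -/
theorem mem_regularOutside_iff_isIntegral {v : ValuationSubring F} {x : F}
    (hx : Transcendental (ZMod p) x) (hxv : x ∈ regularOutside v) (y : F) :
    letI := polynomialAlgebra p x
    y ∈ regularOutside v ↔ IsIntegral (ZMod p)[X] y := by
  let _ := polynomialAlgebra p x
  rw [mem_regularOutside] at hxv ⊢
  -- A function transcendental over 𝔽_p has a pole somewhere, and v is the only place allowed.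
  have hpole : x ∉ v := by
    obtain ⟨V, -, hV⟩ := exists_valuationSubring_of_not_mem_integralClosure (R := ZMod p)
      (fun h ↦ hx h.isAlgebraic)
    have : V = v := by
      by_contra h
      exact hV (hxv V (fun h ↦ hV (h ▸ ValuationSubring.mem_top x)) h)
    exact this ▸ hV
  constructor
  · intro hy
    by_contra hcon
    -- V contains 𝔽_p[x] but not y. It is not v, since v omits x, so y would have a pole at a place
    -- other than v.
    obtain ⟨V, hV, hyV⟩ := exists_valuationSubring_of_not_mem_integralClosure hcon
    have hxV : x ∈ V := by
      have : aeval x (X : (ZMod p)[X]) ∈ V := hV X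
      rwa [aeval_X] at this
    exact hyV (hy V (fun h ↦ hyV (h ▸ ValuationSubring.mem_top y)) fun h ↦ hpole (h ▸ hxV))
  · intro hy V hV hVv
    refine mem_valuationSubring_of_isIntegral V (fun f ↦ ?_) hy
    change aeval x f ∈ V
    rw [aeval_eq_sum_range]
    refine sum_mem fun i _ ↦ ?_
    rw [Algebra.smul_def]
    refine V.mul_mem _ _ ?_ (pow_mem (hxv V hV hVv) i)
    rw [← ZMod.natCast_zmod_val (f.coeff i), map_natCast]
    exact natCast_mem V _

theorem countable_of_finite {R M : Type*} [CommRing R] [Countable R] [AddCommGroup M] [Module R M]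
    [Module.Finite R M] : Countable M := by
  obtain ⟨n, f, hf⟩ := Module.Finite.exists_fin' R M
  exact hf.countable

theorem isDedekindDomain_of_finite (R C : Type*) [CommRing R] [IsDedekindDomain R] [CommRing C]
    [IsDomain C] [Algebra R C] [FaithfulSMul R C] [Module.Finite R C] [IsIntegrallyClosed C] :
    IsDedekindDomain C :=
  { IsNoetherianRing.of_finite R C, Ring.DimensionLEOne.of_isIntegral R C,
    (inferInstance : IsIntegrallyClosed C) with }

end FunctionField

end DrinfeldTate

/-! ### The rings A and B over a common polynomial ring -/

namespace DrinfeldTate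

open Polynomial in
/-- The arithmetic of an infinite integrally closed subring `B` of the ring `A` of functions
regular outside a place. -/
theorem regularOutside_isDedekindDomain {p : ℕ} [Fact p.Prime] {F : Type*} [Field F]
    [Algebra (ZMod p) F] (hF : (⊤ : IntermediateField (ZMod p) F).FG)
    (hF1 : Algebra.trdeg (ZMod p) F = 1) (v : ValuationSubring F) {A : Subring F}
    (hA : A = regularOutside v) (B : Subring A) [Infinite B] [IsIntegrallyClosed B] :
    IsDedekindDomain A ∧ Countable A ∧ IsDedekindDomain B ∧ Module.Finite B A := by
  have : Algebra.EssFiniteType (ZMod p) F := IntermediateField.fg_top_iff.1 hF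
  obtain ⟨x, hxB, hx⟩ := exists_transcendental_of_infinite hF1 (B.map A.subtype)
    (Infinite.of_injective (fun b : B ↦ (⟨b.1.1, b.1, b.2, rfl⟩ : B.map A.subtype))
      fun a b h ↦ Subtype.ext (Subtype.ext
        (congrArg (fun z : B.map A.subtype ↦ (z : F)) h)))
  obtain ⟨⟨x, hxA⟩, hxB, rfl⟩ := hxB
  change Transcendental (ZMod p) x at hx
  let _ := polynomialAlgebra p x
  have := polynomialAlgebra_tower (p := p) x
  have := polynomialAlgebra_faithful hx
  have hmem : ∀ y, y ∈ A ↔ IsIntegral (ZMod p)[X] y := fun y ↦ by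
    rw [hA]
    exact mem_regularOutside_iff_isIntegral hx (hA ▸ hxA) y
  have hfA : ∀ f : (ZMod p)[X], algebraMap (ZMod p)[X] F f ∈ A := fun f ↦
    (hmem _).2 isIntegral_algebraMap
  let _ : Algebra (ZMod p)[X] A := ((algebraMap (ZMod p)[X] F).codRestrict A hfA).toAlgebra
  have : IsScalarTower (ZMod p)[X] A F := IsScalarTower.of_algebraMap_eq fun _ ↦ rfl
  have : IsIntegralClosure A (ZMod p)[X] F :=
    ⟨Subtype.val_injective, fun {y} ↦ ⟨fun hy ↦ ⟨⟨y, (hmem y).2 hy⟩, rfl⟩, by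
      rintro ⟨a, rfl⟩
      exact (hmem _).1 a.2⟩⟩
  have hfin : Module.Finite (ZMod p)[X] A := finite_integralClosure_polynomial hF1 A
  have : FaithfulSMul (ZMod p)[X] A := (faithfulSMul_iff_algebraMap_injective _ _).2 fun f g h ↦
    FaithfulSMul.algebraMap_injective (ZMod p)[X] F (congrArg Subtype.val h)
  -- The constants are images of natural numbers, so B contains all of 𝔽_p[x] once it contains x.
  have hfB : ∀ f : (ZMod p)[X], algebraMap (ZMod p)[X] A f ∈ B := fun f ↦ by
    have hf : algebraMap (ZMod p)[X] A f =
        ∑ i ∈ Finset.range (f.natDegree + 1), ((f.coeff i).val : A) * ⟨x, hxA⟩ ^ i := by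
      refine Subtype.ext ?_
      refine (aeval_eq_sum_range (p := f) x).trans ?_
      rw [AddSubmonoidClass.coe_finsetSum]
      refine Finset.sum_congr rfl fun i _ ↦ ?_
      rw [Algebra.smul_def, ← ZMod.natCast_zmod_val (f.coeff i), map_natCast,
        ZMod.natCast_zmod_val]
      rfl
    rw [hf]
    exact sum_mem fun i _ ↦ B.mul_mem (natCast_mem B _) (pow_mem hxB i)
  let _ : Algebra (ZMod p)[X] B := ((algebraMap (ZMod p)[X] A).codRestrict B hfB).toAlgebra
  have : IsScalarTower (ZMod p)[X] B A := IsScalarTower.of_algebraMap_eq fun _ ↦ rfl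
  have : FaithfulSMul (ZMod p)[X] B := (faithfulSMul_iff_algebraMap_injective _ _).2 fun f g h ↦
    FaithfulSMul.algebraMap_injective (ZMod p)[X] A (congrArg Subtype.val h)
  -- B is a submodule of the finite module A over the noetherian ring 𝔽_p[X]. Being integrally
  -- closed by hypothesis, it will be Dedekind.
  have : Module.Finite (ZMod p)[X] B :=
    Module.Finite.of_injective (IsScalarTower.toAlgHom (ZMod p)[X] B A).toLinearMap
      Subtype.val_injective
  have : Countable (ZMod p)[X] :=
    Cardinal.mk_le_aleph0_iff.1 (Polynomial.cardinalMk_le_max.trans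
      (max_le (Cardinal.mk_le_aleph0_iff.2 inferInstance) le_rfl))
  have hAint : IsIntegrallyClosed A := by
    have : IsIntegrallyClosedIn A F := Subring.isIntegrallyClosedIn_iff.2 fun {y} hy ↦ by
      have : Algebra.IsIntegral (ZMod p)[X] A := inferInstance
      exact (hmem y).2 (isIntegral_trans y hy)
    exact IsIntegrallyClosed.of_isIntegrallyClosedIn A F
  exact ⟨isDedekindDomain_of_finite (ZMod p)[X] A, countable_of_finite (R := (ZMod p)[X]),
    isDedekindDomain_of_finite (ZMod p)[X] B, Module.Finite.of_restrictScalars_finite (ZMod p)[X] B A⟩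

end DrinfeldTate

theorem mainTheorem6 (p : ℕ) [Fact p.Prime]
    -- the function field `F` and the ring `A` of elements regular outside a place
    {F : Type*} [Field F] [Algebra (ZMod p) F]
    (hF : (⊤ : IntermediateField (ZMod p) F).FG) (hF1 : Algebra.trdeg (ZMod p) F = 1)
    (infty : ValuationSubring F) (hinfty : infty ≠ ⊤)
    {A : Subring F} (hA : A = DrinfeldTate.regularOutside infty)
    -- the finitely generated field `K` and its separable closure `L`
    {K : Type*} [Field K] [CharP K p] [Algebra (ZMod p) K]
    (hK : (⊤ : IntermediateField (ZMod p) K).FG)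
    {L : Type*} [Field L] [Algebra K L] [IsSepClosure K L]
    -- the Drinfeld module and the finitely generated torsion free submodule `M ⊆ K`
    (φ : A →+* DrinfeldTate.TwistedPoly p K) (hφ : DrinfeldTate.IsDrinfeld φ)
    (M : Submodule A (DrinfeldTate.Points φ L))
    (hMK : ∀ x ∈ M, ∃ y : K, algebraMap K L y = x)
    (hM : M.FG) (hMtf : Module.IsTorsionFree A M)
    -- the integrally closed infinite subring `B`
    (B : Subring A) [Infinite B] [IsIntegrallyClosed B] :
    -- the sequences for `φ` and for `ψ = φ|B` are exact
    DrinfeldTate.TateSequenceExact (DrinfeldTate.characteristic φ) M ∧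
    DrinfeldTate.TateSequenceExact (DrinfeldTate.characteristic (DrinfeldTate.restrict φ B))
      (DrinfeldTate.restrictSub B M) ∧
    -- the natural homomorphism `π : A_ad → A ⊗_B B_ad`
    ∃ π : DrinfeldTate.Rad φ →ₐ[A] DrinfeldTate.ABad φ B,
      DrinfeldTate.IsNaturalMap _ _ (DrinfeldTate.characteristic_restrict φ B) π ∧
      (∀ π' : DrinfeldTate.Rad φ →ₐ[A] DrinfeldTate.ABad φ B,
        DrinfeldTate.IsNaturalMap _ _ (DrinfeldTate.characteristic_restrict φ B) π' → π' = π) ∧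
      Function.Surjective π ∧
      -- the diagram commutes
      (∀ t : DrinfeldTate.Tad φ L,
        DrinfeldTate.vertTadExt B M (DrinfeldTate.tadIncl M t) =
          DrinfeldTate.tadIncl (DrinfeldTate.restrictSub B M) (DrinfeldTate.vertTad φ B L t)) ∧
      (∀ t : DrinfeldTate.TadExt M,
        DrinfeldTate.vertTensor B M π (DrinfeldTate.tadProj M t) =
          DrinfeldTate.tadProj (DrinfeldTate.restrictSub B M) (DrinfeldTate.vertTadExt B M t)) ∧
      -- the vertical maps identify the lower row with the upper row tensored with `A ⊗_B B_ad`
      DrinfeldTate.IsBaseChangeAlong π.toRingHom (DrinfeldTate.tadModule φ B L)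
        (DrinfeldTate.vertTad φ B L) ∧
      DrinfeldTate.IsBaseChangeAlong π.toRingHom (DrinfeldTate.tadExtModule B M)
        (DrinfeldTate.vertTadExt B M) ∧
      DrinfeldTate.IsBaseChangeAlong π.toRingHom (DrinfeldTate.radTensorModule B M)
        (DrinfeldTate.vertTensor B M π) ∧
      -- the vertical maps are surjective
      Function.Surjective (DrinfeldTate.vertTad φ B L) ∧
      Function.Surjective (DrinfeldTate.vertTadExt B M) ∧
      Function.Surjective (DrinfeldTate.vertTensor B M π) ∧
      -- and bijective if `𝔭₀` is the only prime ideal of `A` above `𝔮₀`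
      ((∀ P : Ideal A, P.IsPrime →
          P.comap (algebraMap B A) = DrinfeldTate.characteristic (DrinfeldTate.restrict φ B) →
          P = DrinfeldTate.characteristic φ) →
        Function.Bijective (DrinfeldTate.vertTad φ B L) ∧
        Function.Bijective (DrinfeldTate.vertTadExt B M) ∧
        Function.Bijective (DrinfeldTate.vertTensor B M π)) := by
  obtain ⟨_, _, _, _⟩ := DrinfeldTate.regularOutside_isDedekindDomain hF hF1 infty hA B
  have : IsSepClosed L := IsSepClosure.sep_closed K
  exact DrinfeldTate.comparison φ M B hM fun a ha y ↦ DrinfeldTate.exists_points_smul_eq φ a ha y
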